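/- Notation. A metric space $X$ is \emph{uniformly locally finite} (u.l.f.) if for every $r>0$ the cardinalities of the balls of radius $r$ in $X$ are uniformly bounded. A \emph{partial translation} of $X$ is a bijection $f\colon \operatorname{dom}(f)\to\operatorname{im}(f)$ between subsets of $X$ with $\sup_{x\in\operatorname{dom}(f)}d(x,f(x))<\infty$. Let $\beta X$ be the space of ultrafilters on $X$ (the Stone–Čech compactification of the discrete space $X$) and let $\partial X\subseteq\beta X$ be the subspace of nonprincipal ultrafilters. If $\operatorname{dom}(f)\in\xi\in\beta X$, let $\overline f(\xi)$ be the ultrafilter of all $B\subseteq X$ such that $f(A)\subseteq B$ for some $A\in\xi$ with $A\subseteq \operatorname{dom}(f)$. The orbit of $\xi$ is $\mathrm{Orb}(\xi)=\{\overline f(\xi) : f \text{ a partial translation with }\operatorname{dom}(f)\in\xi\}$; orbits partition $\partial X$, and $\mathcal{O}rb(\partial X)$ denotes the set of orbits of elements of $\partial X$ with the quotient topology. A nonempty closed subset of a topological space is \emph{irreducible} if it is not the union of two proper closed subsets. The \emph{uniform Roe algebra} $\mathrm C^*_u(X)$ is the $\mathrm C^*$-subalgebra of $\mathcal B(\ell_2(X))$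 generated by the operators $v_f$ ($f$ a partial translation), where $v_f\delta_x=\delta_{f(x)}$ if $x\in\operatorname{dom}(f)$ and $v_f\delta_x=0$ otherwise. Ideals are closed and two-sided. A proper ideal $I$ is \emph{prime} if $I_0I_1\subseteq I$ implies $I_0\subseteq I$ or $I_1\subseteq I$ for all ideals $I_0,I_1$; an ideal is \emph{primitive} if it is the kernel of an irreducible representation on a nonzero Hilbert space. A map $f\colon X\to Y$ of metric spaces is a \emph{coarse embedding} if for all sequences $(x_n)_n,(z_n)_n$ in $X$ one has $d(x_n,z_n)\to\infty$ if and only if $d(f(x_n),f(z_n))\to\infty$. Let $\mathcal M$ be the set of sequences $a=(a_i)_{i\ge1}\in\{0,1\}^{\mathbb N}$ with finitely many nonzero entries, with the metric $d(a,b)=\left|\sum_{i\ge 1}a_i3^i-\sum_{i\ge 1}b_i3^i\right|$, let $\mathcal M_j\subseteq\mathcal M$ be the set of sequences with exactly $j$ entries equal to $1$, and let $\mathcal M_{\le k}=\mathcal M_1\sqcup\dots\sqcup\mathcal M_k\subseteq\mathcal M$. Theorem. Let $X$ be a u.l.f. metric space that coarsely embeds into $\mathcal M_{\le k}$ for some $k\in\mathbb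 N$. Then every irreducible closed subset of $\mathcal{O}rb(\partial X)$ is the closure of a singleton, and an ideal of $\mathrm C^*_u(X)$ is prime if and only if it is primitive. Under these hypotheses $\mathcal{O}rb(\partial X)$ need not be $T_1$: for every $k\ge2$ the space $\mathcal M_{\le k}$ itself is u.l.f. and $\mathcal{O}rb(\partial\mathcal M_{\le k})$ is not $T_1$. -/

import Mathlib

open Filter Topology
open scoped ENNReal

universe u

/-! ## Uniformly locally finite spaces, coarse embeddings, partial translations -/

/-- A metric space is uniformly locally finite if, for every radius, the cardinalities of the balls
of that radius are uniformly bounded. -/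
def UniformlyLocallyFinite (X : Type*) [MetricSpace X] : Prop :=
  ∀ r : ℝ, ∃ N : ℕ, ∀ x : X, (Metric.closedBall x r).encard ≤ N

/-- Coarse embeddings, through sequences. -/
def IsCoarseEmbedding {X Y : Type*} [MetricSpace X] [MetricSpace Y] (f : X → Y) : Prop :=
  ∀ x z : ℕ → X,
    Tendsto (fun n => dist (x n) (z n)) atTop atTop ↔
      Tendsto (fun n => dist (f (x n)) (f (z n))) atTop atTop

/-- The domain of a bijection between two subsets of `X` (a partial equivalence). -/
def PEquiv.domain {X : Type*} (f : X ≃. X) : Set X := {x | (f x).isSome}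

/-- The partial translations of `X`: bijections `f` between subsets of `X` with
`sup_{x ∈ dom f} d(x, f x) < ∞`. -/
def partialTranslations (X : Type*) [MetricSpace X] : Set (X ≃. X) :=
  {f | ∃ r : ℝ, ∀ x y : X, f x = some y → dist x y ≤ r}

/-! ## The action on ultrafilters, orbits and the orbit space of the boundary

The Stone–Čech compactification of the discrete space `X` is Mathlib's space `Ultrafilter X`. -/

/-- For an ultrafilter `ξ` containing `dom f`, the ultrafilter `f̄(ξ)`. -/
def PEquiv.extend {X : Type*} (f : X ≃. X) (ξ : Ultrafilter X) (h : f.domain ∈ ξ) :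
    Ultrafilter X :=
  (ξ.map f).comap (Option.some_injective X) (by
    rw [Ultrafilter.mem_map]
    refine mem_of_superset h ?_
    intro x hx
    obtain ⟨y, hy⟩ := Option.isSome_iff_exists.1 hx
    exact ⟨y, hy.symm⟩)

theorem PEquiv.mem_extend_iff_preimage {X : Type*} (f : X ≃. X) (ξ : Ultrafilter X)
    (h : f.domain ∈ ξ) (B : Set X) :
    B ∈ f.extend ξ h ↔ {x | ∃ y ∈ B, f x = some y} ∈ ξ := by
  unfold PEquiv.extend
  rw [Ultrafilter.mem_comap, Ultrafilter.mem_map]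
  have : (f : X → Option X) ⁻¹' (some '' B) = {x | ∃ y ∈ B, f x = some y} := by
    ext x
    simp only [Set.mem_preimage, Set.mem_image, Set.mem_ofPred_eq, eq_comm]
  rw [this]

/-- `B ∈ f̄(ξ)` if and only if `f(A) ⊆ B` for some `A ∈ ξ` with `A ⊆ dom f`. -/
theorem PEquiv.mem_extend_iff {X : Type*} (f : X ≃. X) (ξ : Ultrafilter X)
    (h : f.domain ∈ ξ) (B : Set X) :
    B ∈ f.extend ξ h ↔
      ∃ A ⊆ f.domain, A ∈ ξ ∧ ∀ x ∈ A, ∀ y, f x = some y → y ∈ B := by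
  rw [PEquiv.mem_extend_iff_preimage]
  constructor
  · intro hB
    refine ⟨_, ?_, hB, ?_⟩
    · rintro x ⟨y, -, hy⟩
      exact Option.isSome_iff_exists.2 ⟨y, hy⟩
    · rintro x ⟨y, hyB, hy⟩ z hz
      rw [hy] at hz
      exact Option.some_injective _ hz ▸ hyB
  · rintro ⟨A, hAd, hA, hAB⟩
    refine mem_of_superset hA fun x hx => ?_
    obtain ⟨y, hy⟩ := Option.isSome_iff_exists.1 (hAd hx)
    exact ⟨y, hAB x hx y hy, hy⟩

/-- The orbit of `ξ ∈ βX` under the partial translations of `X`. -/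
def orbit {X : Type*} [MetricSpace X] (ξ : Ultrafilter X) : Set (Ultrafilter X) :=
  {η | ∃ f ∈ partialTranslations X, ∃ h : f.domain ∈ ξ, f.extend ξ h = η}

theorem mem_orbit_self {X : Type*} [MetricSpace X] (ξ : Ultrafilter X) : ξ ∈ orbit ξ := by
  refine ⟨PEquiv.refl X, ⟨0, ?_⟩, ?_, ?_⟩
  · intro x y hxy
    simp only [PEquiv.refl_apply, Option.some.injEq] at hxy
    simp [hxy]
  · refine mem_of_superset univ_mem fun x _ => ?_
    simp [PEquiv.domain]
  · refine Ultrafilter.ext fun B => ?_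
    rw [PEquiv.mem_extend_iff_preimage]
    simp

theorem orbit_symm {X : Type*} [MetricSpace X] {ξ η : Ultrafilter X} (h : η ∈ orbit ξ) :
    ξ ∈ orbit η := by
  obtain ⟨f, ⟨r, hr⟩, hd, rfl⟩ := h
  have hd' : f.symm.domain ∈ f.extend ξ hd := by
    rw [PEquiv.mem_extend_iff_preimage]
    refine mem_of_superset hd fun x hx => ?_
    obtain ⟨y, hy⟩ := Option.isSome_iff_exists.1 hx
    exact ⟨y, Option.isSome_iff_exists.2 ⟨x, f.eq_some_iff.2 hy⟩, hy⟩
  refine ⟨f.symm, ⟨r, fun x y hxy => ?_⟩, hd', ?_⟩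
  · rw [dist_comm]
    exact hr y x (f.eq_some_iff.1 hxy)
  · refine Ultrafilter.ext fun B => ?_
    rw [PEquiv.mem_extend_iff_preimage, PEquiv.mem_extend_iff_preimage]
    constructor
    · intro hB
      refine mem_of_superset hB ?_
      rintro x ⟨y, ⟨z, hzB, hz⟩, hy⟩
      have := f.eq_some_iff.2 hy
      rw [hz] at this
      exact Option.some_injective _ this ▸ hzB
    · intro hB
      refine mem_of_superset (inter_mem hB hd) ?_
      rintro x ⟨hxB, hx⟩
      obtain ⟨y, hy⟩ := Option.isSome_iff_exists.1 hx
      exact ⟨y, ⟨x, hxB, f.eq_some_iff.2 hy⟩, hy⟩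

theorem orbit_trans {X : Type*} [MetricSpace X] {ξ η ζ : Ultrafilter X} (h : η ∈ orbit ξ)
    (h' : ζ ∈ orbit η) : ζ ∈ orbit ξ := by
  obtain ⟨f, ⟨r, hr⟩, hd, rfl⟩ := h
  obtain ⟨g, ⟨s, hs⟩, hd', rfl⟩ := h'
  have key := (f.mem_extend_iff_preimage ξ hd _).1 hd'
  refine ⟨f.trans g, ⟨r + s, fun x z hxz => ?_⟩, ?_, ?_⟩
  · obtain ⟨y, hy, hz⟩ := (PEquiv.trans_eq_some f g x z).1 hxz
    exact (dist_triangle x y z).trans (add_le_add (hr x y hy) (hs y z hz))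
  · refine mem_of_superset key ?_
    rintro x ⟨y, hyg, hy⟩
    obtain ⟨z, hz⟩ := Option.isSome_iff_exists.1 hyg
    exact Option.isSome_iff_exists.2 ⟨z, (PEquiv.trans_eq_some f g x z).2 ⟨y, hy, hz⟩⟩
  · refine Ultrafilter.ext fun B => ?_
    rw [PEquiv.mem_extend_iff_preimage, PEquiv.mem_extend_iff_preimage,
      PEquiv.mem_extend_iff_preimage]
    have : {x | ∃ z ∈ B, f.trans g x = some z} =
        {x | ∃ y ∈ {y | ∃ z ∈ B, g y = some z}, f x = some y} := by
      ext x
      simp only [Set.mem_ofPred_eq, PEquiv.trans_eq_some]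
      constructor
      · rintro ⟨z, hz, y, hy, hyz⟩
        exact ⟨y, ⟨z, hz, hyz⟩, hy⟩
      · rintro ⟨y, ⟨z, hz, hyz⟩, hy⟩
        exact ⟨z, hz, y, hy, hyz⟩
    rw [this]

/-- The orbit equivalence relation on `βX`. -/
def orbitSetoid (X : Type*) [MetricSpace X] : Setoid (Ultrafilter X) where
  r ξ η := η ∈ orbit ξ
  iseqv := ⟨mem_orbit_self, orbit_symm, orbit_trans⟩

/-- The Stone–Čech boundary `∂X` of the discrete space `X`: the subspace of `βX` of nonprincipal
ultrafilters. -/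
abbrev StoneCechBoundary (X : Type*) : Type _ := {ξ : Ultrafilter X // ∀ x : X, ξ ≠ pure x}

/-- The space of orbits of `∂X`, with the quotient topology. -/
abbrev OrbitSpace (X : Type*) [MetricSpace X] : Type _ :=
  Quotient ((orbitSetoid X).comap (Subtype.val : StoneCechBoundary X → Ultrafilter X))

/-! ## The spaces `M` and `M_1 ⊔ ⋯ ⊔ M_k` -/

/-- The set `M` of finitely supported `0`-`1` sequences. The sequences are indexed by
`{1, 2, 3, …}`: the entry `a i` with `i : ℕ` is the entry at position `i + 1`. -/
def SpaceM : Type := {a : ℕ → Fin 2 // {i | a i = 1}.Finite}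

/-- The support `{i : a_i = 1}` of an element of `M`. -/
def SpaceM.support (a : SpaceM) : Set ℕ := {i | a.1 i = 1}

/-- The natural number `∑_i a_i 3^i`, where `i` runs over `{1, 2, 3, …}`. -/
noncomputable def SpaceM.value (a : SpaceM) : ℕ := ∑ᶠ i : ℕ, (a.1 i : ℕ) * 3 ^ (i + 1)

theorem SpaceM.value_eq (a : SpaceM) : a.value = 3 * ∑ i ∈ a.2.toFinset, 3 ^ i := by
  unfold SpaceM.value
  rw [finsum_eq_sum_of_support_subset (s := a.2.toFinset), Finset.mul_sum]
  · refine Finset.sum_congr rfl fun i hi => ?_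
    have : a.1 i = 1 := by simpa using hi
    rw [this, pow_succ]
    simp [mul_comm]
  · intro i hi
    simp only [Set.Finite.coe_toFinset, Set.mem_ofPred_eq]
    by_contra h
    apply hi
    have : a.1 i = 0 := by omega
    simp [this]

theorem SpaceM.value_injective : Function.Injective SpaceM.value := by
  intro a b hab
  rw [SpaceM.value_eq, SpaceM.value_eq] at hab
  have h : a.2.toFinset = b.2.toFinset :=
    Finset.geomSum_injective (n := 3) (by norm_num) (Nat.eq_of_mul_eq_mul_left (by norm_num) hab)
  apply Subtype.ext
  funext i
  have hi : a.1 i = 1 ↔ b.1 i = 1 := by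
    have := Finset.ext_iff.1 h i
    simpa using this
  omega

/-- The metric `d(a, b) = |∑_i a_i 3^i - ∑_i b_i 3^i|` on `M`. -/
noncomputable instance SpaceM.metricSpace : MetricSpace SpaceM :=
  MetricSpace.induced (fun a => (a.value : ℝ))
    (Nat.cast_injective.comp SpaceM.value_injective) inferInstance

theorem SpaceM.dist_eq (a b : SpaceM) : dist a b = |(a.value : ℝ) - (b.value : ℝ)| := rfl

/-- `M_j`, the elements of `M` with exactly `j` entries equal to `1`. -/
def SpaceM.layer (j : ℕ) : Set SpaceM := {a | a.support.ncard = j}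

/-- The (disjoint) union `M_1 ⊔ ⋯ ⊔ M_k`, a subset of `M`. -/
def SpaceM.layersUpTo (k : ℕ) : Set SpaceM := ⋃ j ∈ Finset.Icc 1 k, SpaceM.layer j

/-! ## The uniform Roe algebra -/

/-- The Hilbert space `ℓ₂(X)`. -/
abbrev EllTwo (X : Type*) : Type _ := lp (fun _ : X => ℂ) 2

/-- The function `y ↦ φ (f⁻¹ y)` on the image of `f`, extended by `0`. -/
def PEquiv.pushforward {X : Type*} (f : X ≃. X) (φ : X → ℂ) (y : X) : ℂ :=
  (f.symm y).elim 0 φ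

theorem PEquiv.sum_pushforward_le {X : Type*} (f : X ≃. X) (φ : EllTwo X) (s : Finset X) :
    ∑ y ∈ s, ‖f.pushforward φ y‖ ^ (2 : ℝ≥0∞).toReal ≤ ‖φ‖ ^ (2 : ℝ≥0∞).toReal := by
  classical
  have h2 : 0 < (2 : ℝ≥0∞).toReal := by norm_num
  set t : Finset X := s.filterMap f.symm (fun a b c hac hbc => f.symm.inj hac hbc) with ht
  refine le_trans ?_ (lp.sum_rpow_le_norm_rpow h2 φ t)
  have hsub : ∑ y ∈ s.filter (fun y => (f.symm y).isSome),
      ‖f.pushforward φ y‖ ^ (2 : ℝ≥0∞).toReal =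
      ∑ y ∈ s, ‖f.pushforward φ y‖ ^ (2 : ℝ≥0∞).toReal := by
    refine Finset.sum_filter_of_ne fun y _ hy => ?_
    by_contra hn
    rw [Option.not_isSome_iff_eq_none] at hn
    exact hy (by simp [PEquiv.pushforward, hn])
  rw [← hsub]
  refine le_of_eq ?_
  refine Finset.sum_bij (fun y hy => (f.symm y).get (Finset.mem_filter.1 hy).2) ?_ ?_ ?_ ?_
  · intro y hy
    rw [ht, Finset.mem_filterMap]
    exact ⟨y, (Finset.mem_filter.1 hy).1, (Option.some_get _).symm⟩
  · intro y hy z hz hyz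
    have h1 : (f.symm y).get (Finset.mem_filter.1 hy).2 ∈ f.symm y := Option.get_mem _
    have h3 : (f.symm z).get (Finset.mem_filter.1 hz).2 ∈ f.symm z := Option.get_mem _
    exact f.symm.inj h1 (by rw [hyz]; exact h3)
  · intro x hx
    rw [ht, Finset.mem_filterMap] at hx
    obtain ⟨y, hys, hy⟩ := hx
    refine ⟨y, Finset.mem_filter.2 ⟨hys, by simp [hy]⟩, by simp [hy]⟩
  · intro y hy
    obtain ⟨x, hx⟩ := Option.isSome_iff_exists.1 (Finset.mem_filter.1 hy).2
    simp [PEquiv.pushforward, hx]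

/-- The partial isometry `v_f` of `ℓ₂(X)`, characterised by `v_f δ_x = δ_{f x}` for `x ∈ dom f` and
`v_f δ_x = 0` for `x ∉ dom f`. -/
noncomputable def PEquiv.partialIsometry {X : Type*} (f : X ≃. X) : EllTwo X →L[ℂ] EllTwo X :=
  LinearMap.mkContinuous
    { toFun := fun φ => ⟨f.pushforward φ, memℓp_gen' (f.sum_pushforward_le φ)⟩
      map_add' := fun φ ψ => by
        ext y
        change f.pushforward (φ + ψ : EllTwo X) y = f.pushforward φ y + f.pushforward ψ y
        unfold PEquiv.pushforward
        rcases f.symm y with _ | x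
        · exact (add_zero (0 : ℂ)).symm
        · rfl
      map_smul' := fun c φ => by
        ext y
        change f.pushforward (c • φ : EllTwo X) y = c • f.pushforward φ y
        unfold PEquiv.pushforward
        rcases f.symm y with _ | x
        · exact (smul_zero c).symm
        · rfl }
    1 (fun φ => by
      rw [one_mul]
      exact lp.norm_le_of_forall_sum_le (by norm_num) (norm_nonneg _) (f.sum_pushforward_le φ))

theorem PEquiv.partialIsometry_single_of_eq_some {X : Type*} [DecidableEq X] (f : X ≃. X) {x y : X}
    (h : f x = some y) :
    f.partialIsometry (lp.single 2 x (1 : ℂ)) = lp.single 2 y (1 : ℂ) := by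
  ext z
  change f.pushforward (lp.single (E := fun _ : X => ℂ) 2 x (1 : ℂ)) z = _
  rw [lp.single_apply, PEquiv.pushforward]
  by_cases hz : z = y
  · subst hz
    rw [f.eq_some_iff.2 h]
    simp [lp.single_apply]
  · rcases hw : f.symm z with _ | w
    · simp [hz]
    · have : w ≠ x := by
        rintro rfl
        rw [f.eq_some_iff, h] at hw
        exact hz (Option.some_injective _ hw).symm
      simp [hz, this]

theorem PEquiv.partialIsometry_single_of_eq_none {X : Type*} [DecidableEq X] (f : X ≃. X) {x : X}
    (h : f x = none) : f.partialIsometry (lp.single 2 x (1 : ℂ)) = 0 := by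
  ext z
  change f.pushforward (lp.single (E := fun _ : X => ℂ) 2 x (1 : ℂ)) z = _
  rw [PEquiv.pushforward]
  rcases hw : f.symm z with _ | w
  · simp
  · have : w ≠ x := by
      rintro rfl
      rw [f.eq_some_iff, h] at hw
      cases hw
    simp [this]

/-- The uniform Roe algebra `C*_u(X)`: the C*-subalgebra of `B(ℓ₂(X))` generated by the operators
`v_f`, for `f` a partial translation of `X`. (It contains the identity operator `v_id`.) -/
noncomputable def uniformRoeAlgebra (X : Type*) [MetricSpace X] :
    StarSubalgebra ℂ (EllTwo X →L[ℂ] EllTwo X) :=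
  (StarAlgebra.adjoin ℂ (PEquiv.partialIsometry '' partialTranslations X)).topologicalClosure

/-! ## Prime and primitive ideals of unital C*-algebras

As usual for C*-algebras, the ideals in question are the norm-closed two-sided ideals. -/

/-- A closed ideal `I` is prime if it is proper and, for all closed ideals `I₀`, `I₁` with
`I₀ I₁ ⊆ I`, one has `I₀ ⊆ I` or `I₁ ⊆ I`. -/
def IsPrimeIdeal {A : Type*} [Ring A] [TopologicalSpace A] (I : TwoSidedIdeal A) : Prop :=
  IsClosed (I : Set A) ∧ (I : Set A) ≠ Set.univ ∧
    ∀ I₀ I₁ : TwoSidedIdeal A, IsClosed (I₀ : Set A) → IsClosed (I₁ : Set A) →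
      (∀ a ∈ I₀, ∀ b ∈ I₁, a * b ∈ I) → I₀ ≤ I ∨ I₁ ≤ I

/-- A (unital) `*`-representation on a nonzero Hilbert space is irreducible if it has no invariant
closed subspaces other than `0` and the whole space. -/
def IsIrreducibleRep {A H : Type*} [Ring A] [StarRing A] [Algebra ℂ A] [NormedAddCommGroup H]
    [InnerProductSpace ℂ H] [CompleteSpace H] (π : A →⋆ₐ[ℂ] (H →L[ℂ] H)) : Prop :=
  Nontrivial H ∧ ∀ K : Submodule ℂ H, IsClosed (K : Set H) →
    (∀ a : A, ∀ v ∈ K, π a v ∈ K) → K = ⊥ ∨ K = ⊤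

/-- An ideal is primitive if it is the kernel of an irreducible representation. (An irreducible
representation is cyclic, so it is unitarily equivalent to one on a Hilbert space that lives in the
universe of the algebra.) -/
def IsPrimitiveIdeal {A : Type u} [Ring A] [StarRing A] [Algebra ℂ A] (I : TwoSidedIdeal A) :
    Prop :=
  ∃ (H : Type u) (_ : NormedAddCommGroup H) (_ : InnerProductSpace ℂ H) (_ : CompleteSpace H)
    (π : A →⋆ₐ[ℂ] (H →L[ℂ] H)), IsIrreducibleRep π ∧ I = TwoSidedIdeal.ker π

/-!
A space `X` that coarsely embeds into `M_1 ⊔ ⋯ ⊔ M_k` is filtered by equivalence relations: two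
points lie in the same `n`-block if the supports of their images in `M` agree from position `n` on.
Sums of distinct powers of three lie close together exactly if their high terms agree, so these
relations generate the bounded coarse structure (`IsCoarseEmbedding.blockFiltration`), and `X` has
asymptotic dimension zero. An ultrafilter has a set `A` in some member of its orbit exactly if it
contains the `n`-saturation of `A` for some `n` (`BlockFiltration.exists_mem_orbit_iff`).

Both irreducible closed sets of orbits and prime ideals of the uniform Roe algebra yield a prime
ideal of subsets of `X` that is invariant under saturation: the sets that belong to no ultrafilter
over the closed set, and the sets `T` with `1_T` in the ideal. The bound `k` on the size of supports
enters in `BlockFiltration.IsPrimeSetIdeal.exists_generic`: such an ideal of sets consists of the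
sets whose saturations all avoid one ultrafilter `ξ`. In the first case the orbit of `ξ` is the
generic point (`BlockFiltration.exists_eq_closure_singleton`).

In the second case, consider the functional `a ↦ lim_{x → ξ} ⟨δ_x, a δ_x⟩`. Its GNS representation
is irreducible, because the projections `1_T` with `T ∈ ξ` excise the functional
(`isIrreducibleRep_of_excision`, `BlockFiltration.exists_excision`), and its kernel contains the
same `1_T` as the prime ideal. Closed ideals are determined by the projections `1_T` in them
(`BlockFiltration.ideal_le_of_roeProj`): an element of an ideal is approximated by a block diagonal
operator `b`; the union of the blocks on which `b` has large norm is a set `S` with `1_S` in the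
ideal, and `b` is close to `b 1_S`. That primitive ideals are prime is a general fact
(`IsPrimitiveIdeal.isPrimeIdeal`).

For `k ≥ 2` the boundary orbits of `M_1 ⊔ ⋯ ⊔ M_k` are not all closed: the orbit of a limit of the
points `{l}` contains the limits over `l` of the points `{m, l}` for every `m`, but not the iterated
limit of these as `m` grows (`not_t1Space_orbitSpace_layersUpTo`).
-/

/-! ### Partial bijections and partial translations -/

open Classical in
/-- The partial bijection whose graph is a given relation that is functional in both directions. -/
noncomputable def PEquiv.ofRel {X : Type*} (R : X → X → Prop)
    (h₁ : ∀ x y z, R x y → R x z → y = z) (h₂ : ∀ x y z, R x z → R y z → x = y) : X ≃. X where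
  toFun x := if h : ∃ y, R x y then some h.choose else none
  invFun y := if h : ∃ x, R x y then some h.choose else none
  inv x y := by
    constructor
    · intro h
      split_ifs at h with h'
      · have hx := h'.choose_spec
        rw [Option.mem_some_iff.1 h] at hx
        have : ∃ y, R x y := ⟨y, hx⟩
        rw [dif_pos this]
        exact Option.mem_some_iff.2 (h₁ _ _ _ this.choose_spec hx)
    · intro h
      split_ifs at h with h'
      · have hx := h'.choose_spec
        rw [Option.mem_some_iff.1 h] at hx
        have : ∃ x, R x y := ⟨x, hx⟩
        rw [dif_pos this]
        exact Option.mem_some_iff.2 (h₂ _ _ _ this.choose_spec hx)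

open Classical in
theorem PEquiv.ofRel_eq_some {X : Type*} {R : X → X → Prop}
    {h₁ : ∀ x y z, R x y → R x z → y = z} {h₂ : ∀ x y z, R x z → R y z → x = y} {x y : X} :
    PEquiv.ofRel R h₁ h₂ x = some y ↔ R x y := by
  change (if h : ∃ y, R x y then some h.choose else none) = some y ↔ R x y
  constructor
  · intro h
    split_ifs at h with h'
    rw [← Option.some_injective _ h]
    exact h'.choose_spec
  · intro h
    have : ∃ y, R x y := ⟨y, h⟩
    rw [dif_pos this, h₁ _ _ _ this.choose_spec h]

theorem PEquiv.mem_domain {X : Type*} {f : X ≃. X} {x : X} :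
    x ∈ f.domain ↔ ∃ y, f x = some y := Option.isSome_iff_exists

/-! ### Filtrations of a coarse structure by equivalence relations -/

/-- An increasing sequence of equivalence relations that generates the bounded coarse structure of
a metric space. Spaces of asymptotic dimension zero are those that admit one. The equivalence
classes of `rel n` are called the `n`-blocks. -/
structure BlockFiltration (X : Type*) [MetricSpace X] where
  rel : ℕ → Setoid X
  mono : Monotone rel
  exists_rel_of_dist_le : ∀ r : ℝ, ∃ n, ∀ x y, dist x y ≤ r → rel n x y
  exists_dist_le_of_rel : ∀ n, ∃ r : ℝ, ∀ x y, rel n x y → dist x y ≤ r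

namespace BlockFiltration

variable {X : Type*} [MetricSpace X] (E : BlockFiltration X)

/-- The union of the `n`-blocks that meet `A`. -/
def sat (n : ℕ) (A : Set X) : Set X := {x | ∃ y ∈ A, E.rel n x y}

/-- A set is `n`-saturated if it is a union of `n`-blocks. -/
def IsSaturated (n : ℕ) (A : Set X) : Prop := ∀ x y, E.rel n x y → x ∈ A → y ∈ A

theorem rel_mono {m n : ℕ} (h : m ≤ n) {x y : X} (hxy : E.rel m x y) : E.rel n x y :=
  E.mono h hxy

theorem subset_sat (n : ℕ) (A : Set X) : A ⊆ E.sat n A :=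
  fun x hx => ⟨x, hx, (E.rel n).refl x⟩

theorem sat_mono {m n : ℕ} (h : m ≤ n) {A B : Set X} (hAB : A ⊆ B) : E.sat m A ⊆ E.sat n B :=
  fun _ ⟨y, hy, hxy⟩ => ⟨y, hAB hy, E.rel_mono h hxy⟩

theorem isSaturated_sat (n : ℕ) (A : Set X) : E.IsSaturated n (E.sat n A) :=
  fun _ _ hxy ⟨z, hz, hxz⟩ => ⟨z, hz, (E.rel n).trans ((E.rel n).symm hxy) hxz⟩

variable {E}

theorem IsSaturated.inter {n : ℕ} {A B : Set X} (hA : E.IsSaturated n A)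
    (hB : E.IsSaturated n B) : E.IsSaturated n (A ∩ B) :=
  fun x y hxy hx => ⟨hA x y hxy hx.1, hB x y hxy hx.2⟩

theorem IsSaturated.anti {m n : ℕ} (h : m ≤ n) {A : Set X} (hA : E.IsSaturated n A) :
    E.IsSaturated m A :=
  fun x y hxy hx => hA x y (E.rel_mono h hxy) hx

variable (E)

/-- In a uniformly locally finite space the blocks of a given level are uniformly finite, so that
finitely many colours suffice to give the points of each block different colours. -/
theorem exists_coloring (hX : UniformlyLocallyFinite X) (n : ℕ) :
    ∃ (N : ℕ) (c : X → Fin N), ∀ x y, E.rel n x y → c x = c y → x = y := by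
  obtain ⟨r, hr⟩ := E.exists_dist_le_of_rel n
  obtain ⟨N, hN⟩ := hX r
  have key : ∀ q : Quotient (E.rel n), ∃ g : X → Fin N,
      ∀ x y, Quotient.mk _ x = q → Quotient.mk _ y = q → g x = g y → x = y := by
    intro q
    obtain ⟨z, rfl⟩ := q.exists_rep
    have hsub : {y : X | Quotient.mk (E.rel n) y = Quotient.mk _ z} ⊆ Metric.closedBall z r :=
      fun y hy => hr _ _ (Quotient.exact hy)
    have hcard := (Set.encard_le_encard hsub).trans (hN z)
    have hfin := Set.finite_of_encard_le_coe hcard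
    have hN' : 0 < N := Nat.pos_of_ne_zero fun h0 => by
      rw [h0, Nat.cast_zero, nonpos_iff_eq_zero, Set.encard_eq_zero] at hcard
      exact Set.eq_empty_iff_forall_notMem.1 hcard z rfl
    have : Nonempty (Fin N) := ⟨⟨0, hN'⟩⟩
    obtain ⟨g, -, hg⟩ := hfin.exists_injOn_of_encard_le (t := (Set.univ : Set (Fin N)))
      (by rwa [Set.encard_univ, ENat.card_eq_coe_fintype_card, Fintype.card_fin])
    exact ⟨g, fun x y hx hy hxy => hg hx hy hxy⟩
  choose g hg using key
  refine ⟨N, fun x => g (Quotient.mk _ x) x, fun x y hxy hc => ?_⟩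
  have hq : Quotient.mk (E.rel n) y = Quotient.mk (E.rel n) x :=
    Quotient.sound ((E.rel n).symm hxy)
  refine hg _ x y rfl hq ?_
  simpa only [hq] using hc

theorem exists_rel_of_mem_partialTranslations {f : X ≃. X} (hf : f ∈ partialTranslations X) :
    ∃ n, ∀ x y, f x = some y → E.rel n x y := by
  obtain ⟨r, hr⟩ := hf
  obtain ⟨n, hn⟩ := E.exists_rel_of_dist_le r
  exact ⟨n, fun x y h => hn x y (hr x y h)⟩

theorem mem_partialTranslations {f : X ≃. X} {n : ℕ} (h : ∀ x y, f x = some y → E.rel n x y) :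
    f ∈ partialTranslations X := by
  obtain ⟨r, hr⟩ := E.exists_dist_le_of_rel n
  exact ⟨r, fun x y hxy => hr x y (h x y hxy)⟩

/-- The saturation of `A` is covered by the domains of finitely many partial translations into
`A`. -/
theorem exists_partialTranslations_cover (hX : UniformlyLocallyFinite X) (n : ℕ) (A : Set X) :
    ∃ (N : ℕ) (f : Fin N → X ≃. X), (∀ i, f i ∈ partialTranslations X) ∧
      (∀ i x y, f i x = some y → y ∈ A) ∧ ∀ x ∈ E.sat n A, ∃ i, x ∈ (f i).domain := by
  classical
  obtain ⟨N, c, hc⟩ := E.exists_coloring hX n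
  have hg : ∀ x, ∃ y, x ∈ E.sat n A → y ∈ A ∧ E.rel n x y := by
    intro x
    by_cases hx : x ∈ E.sat n A
    · obtain ⟨y, hy⟩ := hx
      exact ⟨y, fun _ => hy⟩
    · exact ⟨x, fun h => absurd h hx⟩
  choose g hg using hg
  let R : Fin N → X → X → Prop := fun i x y => x ∈ E.sat n A ∧ c x = i ∧ g x = y
  refine ⟨N, fun i => PEquiv.ofRel (R i) ?_ ?_, fun i => ?_, ?_, ?_⟩
  · rintro x y z ⟨-, -, rfl⟩ ⟨-, -, rfl⟩
    rfl
  · rintro x y z ⟨hx, hcx, hgx⟩ ⟨hy, hcy, hgy⟩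
    have h1 := (hg x hx).2
    have h2 := (hg y hy).2
    rw [hgx] at h1
    rw [hgy] at h2
    exact hc x y ((E.rel n).trans h1 ((E.rel n).symm h2)) (hcx.trans hcy.symm)
  · refine E.mem_partialTranslations (n := n) fun x y h => ?_
    obtain ⟨hx, -, rfl⟩ := PEquiv.ofRel_eq_some.1 h
    exact (hg x hx).2
  · intro i x y h
    obtain ⟨hx, -, rfl⟩ := PEquiv.ofRel_eq_some.1 h
    exact (hg x hx).1
  · intro x hx
    exact ⟨c x, PEquiv.mem_domain.2 ⟨g x, PEquiv.ofRel_eq_some.2 ⟨hx, rfl, rfl⟩⟩⟩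

theorem exists_partialTranslation_of_sat_mem (hX : UniformlyLocallyFinite X) {n : ℕ} {A : Set X}
    {ξ : Ultrafilter X} (h : E.sat n A ∈ ξ) :
    ∃ f ∈ partialTranslations X, f.domain ∈ ξ ∧ ∀ x y, f x = some y → y ∈ A := by
  obtain ⟨N, f, hf, hfA, hcov⟩ := E.exists_partialTranslations_cover hX n A
  have h' : (⋃ i ∈ (Set.univ : Set (Fin N)), (f i).domain) ∈ ξ := by
    refine mem_of_superset h fun x hx => ?_
    obtain ⟨i, hi⟩ := hcov x hx
    exact Set.mem_biUnion (Set.mem_univ i) hi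
  obtain ⟨i, -, hi⟩ := (Ultrafilter.finite_biUnion_mem_iff Set.finite_univ).1 h'
  exact ⟨f i, hf i, hi, hfA i⟩

/-- A basic open set `{ζ | A ∈ ζ}` meets the orbit of `ξ` exactly if some saturation of `A` lies
in `ξ`. -/
theorem exists_mem_orbit_iff (hX : UniformlyLocallyFinite X) {A : Set X} {ξ : Ultrafilter X} :
    (∃ ζ ∈ orbit ξ, A ∈ ζ) ↔ ∃ n, E.sat n A ∈ ξ := by
  constructor
  · rintro ⟨ζ, ⟨f, hf, hd, rfl⟩, hA⟩
    obtain ⟨n, hn⟩ := E.exists_rel_of_mem_partialTranslations hf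
    rw [PEquiv.mem_extend_iff_preimage] at hA
    refine ⟨n, mem_of_superset hA ?_⟩
    rintro x ⟨y, hy, hxy⟩
    exact ⟨y, hy, hn x y hxy⟩
  · rintro ⟨n, h⟩
    obtain ⟨f, hf, hd, hfA⟩ := E.exists_partialTranslation_of_sat_mem hX h
    refine ⟨f.extend ξ hd, ⟨f, hf, hd, rfl⟩, ?_⟩
    rw [PEquiv.mem_extend_iff_preimage]
    refine mem_of_superset hd fun x hx => ?_
    obtain ⟨y, hy⟩ := PEquiv.mem_domain.1 hx
    exact ⟨y, hfA x y hy, hy⟩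

/-! ### Prime ideals of sets and their generic ultrafilters -/

/-- A proper ideal of subsets that is invariant under saturation and prime among such ideals. -/
structure IsPrimeSetIdeal (I : Set (Set X)) : Prop where
  empty_mem : ∅ ∈ I
  union_mem : ∀ A ∈ I, ∀ B ∈ I, A ∪ B ∈ I
  subset_mem : ∀ A ∈ I, ∀ B ⊆ A, B ∈ I
  sat_mem : ∀ n, ∀ A ∈ I, E.sat n A ∈ I
  univ_notMem : Set.univ ∉ I
  prime : ∀ A ∉ I, ∀ B ∉ I, ∃ n, E.sat n A ∩ E.sat n B ∉ I

/-- `t` assigns to each point at most `k` natural numbers, and points lie in the same `n`-block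
exactly if their sets agree from `n` on. -/
def IsTailFiltration (k : ℕ) (t : X → Finset ℕ) : Prop :=
  (∀ x, (t x).card ≤ k) ∧
    ∀ n x y, E.rel n x y ↔ (t x).filter (n ≤ ·) = (t y).filter (n ≤ ·)

variable {E}

theorem IsPrimeSetIdeal.exists_ultrafilter {I : Set (Set X)} (hI : E.IsPrimeSetIdeal I) {Y : Set X}
    (hY : Y ∉ I) : ∃ ξ : Ultrafilter X, Y ∈ ξ ∧ ∀ A ∈ I, A ∉ ξ := by
  -- the dual filter of `I`, restricted to `Y`
  let F : Filter X :=
    { sets := {B | Y \ B ∈ I}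
      univ_sets := by simpa using hI.empty_mem
      sets_of_superset := fun {A B} hA hAB =>
        hI.subset_mem _ hA _ (Set.sdiff_subset_sdiff_right hAB)
      inter_sets := fun {A B} hA hB => by
        change Y \ (A ∩ B) ∈ I
        rw [Set.sdiff_inter]
        exact hI.union_mem _ hA _ hB }
  have hF : F.NeBot := ⟨fun h => hY (by
    have : (∅ : Set X) ∈ F := h ▸ mem_bot
    simpa using (show Y \ ∅ ∈ I from this))⟩
  refine ⟨Ultrafilter.of F, Ultrafilter.of_le F ?_, fun A hA hAξ => ?_⟩
  · change Y \ Y ∈ I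
    simpa using hI.empty_mem
  · have : Aᶜ ∈ Ultrafilter.of F := Ultrafilter.of_le F (by
      change Y \ Aᶜ ∈ I
      exact hI.subset_mem _ hA _ fun x hx => not_not.1 hx.2)
    exact (Ultrafilter.compl_mem_iff_notMem.1 this) hAξ

/-- For the filtrations by tails, each prime ideal of sets is the ideal of those sets whose
saturations all avoid a single ultrafilter. The number of entries from `n` on takes a least value
`j` on sets outside the ideal; on such a set with value `j` at level `n`, disjoint `n`-saturated
sets stay disjoint at all higher levels up to the ideal, so that primeness leaves only one
ultrafilter of `n`-saturated sets. -/
theorem IsPrimeSetIdeal.exists_generic {k : ℕ} {t : X → Finset ℕ} (ht : E.IsTailFiltration k t)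
    {I : Set (Set X)} (hI : E.IsPrimeSetIdeal I) :
    ∃ ξ : Ultrafilter X, ∀ A, A ∈ I ↔ ∀ n, E.sat n A ∉ ξ := by
  classical
  let T : ℕ → X → Finset ℕ := fun n x => (t x).filter (n ≤ ·)
  have hT : ∀ {m n : ℕ}, m ≤ n → ∀ x, T n x ⊆ T m x := fun h x i hi => by
    simp only [T, Finset.mem_filter] at hi ⊢
    exact ⟨hi.1, h.trans hi.2⟩
  let L : ℕ → ℕ → Set X := fun j n => {x | (T n x).card = j}
  have hunion : ∀ (s : ℕ) (A : ℕ → Set X), (∀ j < s, A j ∈ I) →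
      {x | ∃ j < s, x ∈ A j} ∈ I := by
    intro s A
    induction s with
    | zero => intro _; simpa using hI.empty_mem
    | succ s ih =>
      intro h
      refine hI.subset_mem _ (hI.union_mem _ (ih fun j hj => h j (by omega)) _
        (h s (by omega))) _ ?_
      rintro x ⟨j, hj, hx⟩
      rcases Nat.lt_succ_iff_lt_or_eq.1 hj with hj | rfl
      · exact Or.inl ⟨j, hj, hx⟩
      · exact Or.inr hx
  have hex : ∃ j, ∃ n, L j n ∉ I := by
    by_contra! hcon
    refine hI.univ_notMem (hI.subset_mem _ (hunion (k + 1) (fun j => L j 0)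
      fun j _ => hcon j 0) _ fun x _ => ⟨(T 0 x).card, ?_, rfl⟩)
    exact Nat.lt_succ_of_le ((Finset.card_filter_le _ _).trans (ht.1 x))
  obtain ⟨n₀, hn₀⟩ := Nat.find_spec hex
  have hmin : ∀ j < Nat.find hex, ∀ n, L j n ∈ I := fun j hj n => by
    by_contra h
    exact Nat.find_min hex hj ⟨n, h⟩
  set j₀ := Nat.find hex
  set Y := L j₀ n₀ with hYdef
  have hYsat : E.IsSaturated n₀ Y := fun x y hxy hx => by
    have : T n₀ x = T n₀ y := (ht.2 n₀ x y).1 hxy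
    change (T n₀ y).card = j₀
    rw [← this]
    exact hx
  -- If points of `Y` in different `n₀`-blocks share a block at a higher level, then that block has
  -- fewer than `j₀` entries there, and by minimality the union of such blocks belongs to `I`.
  have hsep : ∀ A B : Set X, A ⊆ Y → B ⊆ Y → E.IsSaturated n₀ A → Disjoint A B →
      A ∈ I ∨ B ∈ I := by
    intro A B hAY hBY hA hAB
    by_contra! hcon
    obtain ⟨n, hn⟩ := hI.prime A hcon.1 B hcon.2
    refine hn (hI.subset_mem _ (hunion j₀ (fun j => L j (max n n₀))
      fun j hj => hmin j hj _) _ ?_)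
    rintro z ⟨⟨a, ha, hza⟩, ⟨b, hb, hzb⟩⟩
    have hle : n ≤ max n n₀ := le_max_left _ _
    have hle' : n₀ ≤ max n n₀ := le_max_right _ _
    have hza' : T (max n n₀) z = T (max n n₀) a := (ht.2 _ _ _).1 (E.rel_mono hle hza)
    have hzb' : T (max n n₀) z = T (max n n₀) b := (ht.2 _ _ _).1 (E.rel_mono hle hzb)
    have hac : (T n₀ a).card = j₀ := hAY ha
    have hbc : (T n₀ b).card = j₀ := hBY hb
    refine ⟨(T (max n n₀) z).card, ?_, rfl⟩
    by_contra hlt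
    have h1 : T (max n n₀) a = T n₀ a :=
      Finset.eq_of_subset_of_card_le (hT hle' a) (by rw [hac, ← hza']; omega)
    have h2 : T (max n n₀) b = T n₀ b :=
      Finset.eq_of_subset_of_card_le (hT hle' b) (by rw [hbc, ← hzb']; omega)
    have hab : E.rel n₀ a b := (ht.2 _ _ _).2 (by
      change T n₀ a = T n₀ b
      rw [← h1, ← h2, ← hza', hzb'])
    exact Set.disjoint_left.1 hAB (hA a b hab ha) hb
  obtain ⟨ξ, hYξ, hξ⟩ := hI.exists_ultrafilter hn₀
  refine ⟨ξ, fun A => ⟨fun hA n => hξ _ (hI.sat_mem n A hA), fun hA => ?_⟩⟩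
  by_contra hAI
  obtain ⟨n, hn⟩ := hI.prime A hAI Y hn₀
  have hle : n ≤ max n n₀ := le_max_left _ _
  set D := E.sat (max n n₀) A ∩ Y with hD
  have hDI : D ∉ I := fun h => hn (hI.subset_mem _ (hI.sat_mem (max n n₀) D h) _ (by
    rintro z ⟨⟨a, ha, hza⟩, ⟨y, hy, hzy⟩⟩
    refine ⟨y, ⟨⟨a, ha, E.rel_mono hle ?_⟩, hy⟩, E.rel_mono hle hzy⟩
    exact (E.rel n).trans ((E.rel n).symm hzy) hza))
  have hDsat : E.IsSaturated n₀ D :=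
    ((E.isSaturated_sat _ A).anti (le_max_right _ _)).inter hYsat
  -- `D ⊆ Y` is `n₀`-saturated and not in `I`, so its complement in `Y` is in `I` and avoids `ξ`.
  have hcompl : Y \ D ∈ I :=
    (hsep D (Y \ D) Set.inter_subset_right Set.sdiff_subset hDsat
      Set.disjoint_sdiff_right).resolve_left hDI
  refine hA (max n n₀) ?_
  by_contra hnot
  refine hξ _ hcompl (mem_of_superset
    (inter_mem hYξ (Ultrafilter.compl_mem_iff_notMem.2 hnot)) ?_)
  exact fun x hx => ⟨hx.1, fun h => hx.2 h.1⟩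

end BlockFiltration

/-! ### Irreducible closed sets of orbits -/

theorem exists_subset_of_isOpen_boundary {X : Type*} {O : Set (StoneCechBoundary X)}
    (hO : IsOpen O) {ξ : StoneCechBoundary X} (hξ : ξ ∈ O) :
    ∃ A ∈ ξ.1, ∀ η : StoneCechBoundary X, A ∈ η.1 → η ∈ O := by
  obtain ⟨U, hU, rfl⟩ := isOpen_induced_iff.1 hO
  obtain ⟨V, ⟨A, rfl⟩, hA, hAU⟩ :=
    ultrafilterBasis_is_basis.exists_subset_of_mem_open (show ξ.1 ∈ U from hξ) hU
  exact ⟨A, hA, fun η hη => hAU hη⟩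

theorem ne_pure_of_mem_orbit {X : Type*} [MetricSpace X] {ξ η : Ultrafilter X}
    (hξ : ∀ x, ξ ≠ pure x) (h : η ∈ orbit ξ) (y : X) : η ≠ pure y := by
  rintro rfl
  obtain ⟨f, -, hd, hf⟩ := orbit_symm h
  rw [Ultrafilter.mem_pure, PEquiv.mem_domain] at hd
  obtain ⟨x, hx⟩ := hd
  refine hξ x (hf.symm.trans (Ultrafilter.ext fun B => ?_))
  rw [PEquiv.mem_extend_iff_preimage]
  simp [hx]

/-- The orbit of a nonprincipal ultrafilter, as a point of the orbit space. -/
abbrev orbitMk {X : Type*} [MetricSpace X] (ξ : StoneCechBoundary X) : OrbitSpace X :=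
  Quotient.mk _ ξ

theorem orbitMk_eq_iff {X : Type*} [MetricSpace X] {ξ η : StoneCechBoundary X} :
    orbitMk ξ = orbitMk η ↔ η.1 ∈ orbit ξ.1 := Quotient.eq

namespace BlockFiltration

variable {X : Type*} [MetricSpace X] (E : BlockFiltration X)

theorem exists_orbitMk_eq_iff (hX : UniformlyLocallyFinite X) {A : Set X}
    (ξ : StoneCechBoundary X) :
    (∃ ζ : StoneCechBoundary X, A ∈ ζ.1 ∧ orbitMk ζ = orbitMk ξ) ↔ ∃ n, E.sat n A ∈ ξ.1 := by
  rw [← E.exists_mem_orbit_iff hX]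
  constructor
  · rintro ⟨ζ, hA, h⟩
    exact ⟨ζ.1, orbitMk_eq_iff.1 h.symm, hA⟩
  · rintro ⟨ζ, h, hA⟩
    exact ⟨⟨ζ, ne_pure_of_mem_orbit ξ.2 h⟩, hA, (orbitMk_eq_iff.2 h).symm⟩

theorem isOpen_orbitMk_image (E : BlockFiltration X) (hX : UniformlyLocallyFinite X) (A : Set X) :
    IsOpen (orbitMk '' {ζ : StoneCechBoundary X | A ∈ ζ.1}) := by
  have hq : IsQuotientMap (orbitMk : StoneCechBoundary X → OrbitSpace X) := isQuotientMap_quot_mk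
  rw [← hq.isOpen_preimage]
  have : (orbitMk ⁻¹' (orbitMk '' {ζ : StoneCechBoundary X | A ∈ ζ.1}) :
      Set (StoneCechBoundary X)) = ⋃ n, Subtype.val ⁻¹' {ξ : Ultrafilter X | E.sat n A ∈ ξ} := by
    ext ξ
    simp only [Set.mem_iUnion]
    exact E.exists_orbitMk_eq_iff hX ξ
  rw [this]
  exact isOpen_iUnion fun n => (ultrafilter_isOpen_basic _).preimage continuous_subtype_val

/-- If prime ideals of sets have generic ultrafilters, then irreducible closed sets of orbits have
generic points: the sets that belong to no ultrafilter over `F` form a prime ideal. -/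
theorem exists_eq_closure_singleton (hX : UniformlyLocallyFinite X)
    (hgen : ∀ I : Set (Set X), E.IsPrimeSetIdeal I →
      ∃ ξ : Ultrafilter X, ∀ A, A ∈ I ↔ ∀ n, E.sat n A ∉ ξ)
    (F : Set (OrbitSpace X)) (hF : IsClosed F) (hirr : IsIrreducible F) :
    ∃ p, F = closure {p} := by
  have hgenF : E.IsPrimeSetIdeal {A | ∀ η : StoneCechBoundary X, orbitMk η ∈ F → A ∉ η.1} := by
    refine ⟨fun η _ => η.1.empty_notMem, fun A hA B hB η hη h => ?_, fun A hA B hBA η hη h => ?_,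
      fun n A hA η hη h => ?_, fun h => ?_, fun A hA B hB => ?_⟩
    · exact (Ultrafilter.union_mem_iff.1 h).elim (hA η hη) (hB η hη)
    · exact hA η hη (mem_of_superset h hBA)
    · obtain ⟨ζ, hζ, hζη⟩ := (E.exists_orbitMk_eq_iff hX η).2 ⟨n, h⟩
      exact hA ζ (hζη ▸ hη) hζ
    · obtain ⟨p, hp⟩ := hirr.nonempty
      obtain ⟨η, rfl⟩ := p.exists_rep
      exact h η hp univ_mem
    · simp only [Set.mem_ofPred_eq, not_forall, not_not] at hA hB
      obtain ⟨α, hαF, hα⟩ := hA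
      obtain ⟨β, hβF, hβ⟩ := hB
      obtain ⟨p, hpF, ⟨α', hα', hαp⟩, ⟨β', hβ', hβp⟩⟩ := hirr.isPreirreducible _ _
        (E.isOpen_orbitMk_image hX A) (E.isOpen_orbitMk_image hX B)
        ⟨_, hαF, α, hα, rfl⟩ ⟨_, hβF, β, hβ, rfl⟩
      obtain ⟨ζ, rfl⟩ := p.exists_rep
      obtain ⟨m, hm⟩ := (E.exists_orbitMk_eq_iff hX ζ).1 ⟨α', hα', hαp⟩
      obtain ⟨n, hn⟩ := (E.exists_orbitMk_eq_iff hX ζ).1 ⟨β', hβ', hβp⟩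
      exact ⟨max m n, fun h => h ζ hpF (mem_of_superset (inter_mem hm hn)
        (Set.inter_subset_inter (E.sat_mono (le_max_left _ _) subset_rfl)
          (E.sat_mono (le_max_right _ _) subset_rfl)))⟩
  obtain ⟨ξ, hξ⟩ := hgen _ hgenF
  have hξ' : ∀ A ∈ ξ, ∃ η : StoneCechBoundary X, orbitMk η ∈ F ∧ A ∈ η.1 := by
    intro A hA
    by_contra! hcon
    exact (hξ A).1 hcon 0 (mem_of_superset hA (E.subset_sat 0 A))
  have hnp : ∀ x, ξ ≠ pure x := by
    rintro x rfl
    obtain ⟨η, -, hη⟩ := hξ' {x} rfl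
    exact η.2 x (Ultrafilter.eq_of_le (by simpa using hη))
  refine ⟨orbitMk ⟨ξ, hnp⟩, Set.Subset.antisymm (fun q hq => ?_)
    (closure_minimal (Set.singleton_subset_iff.2 ?_) hF)⟩
  · obtain ⟨η, rfl⟩ := q.exists_rep
    refine mem_closure_iff.2 fun O hO hηO => ?_
    obtain ⟨A, hA, hAO⟩ := exists_subset_of_isOpen_boundary
      (hO.preimage (continuous_quotient_mk' (s := (orbitSetoid X).comap Subtype.val))) hηO
    have hn : ∃ n, E.sat n A ∈ ξ := by
      by_contra! hcon
      exact (hξ A).2 hcon η hq hA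
    obtain ⟨ζ, hζA, hζ⟩ := (E.exists_orbitMk_eq_iff hX ⟨ξ, hnp⟩).2 hn
    exact ⟨_, hAO ζ hζA, hζ⟩
  · by_contra hcon
    obtain ⟨A, hA, hAO⟩ := exists_subset_of_isOpen_boundary
      (hF.isOpen_compl.preimage (continuous_quotient_mk'
        (s := (orbitSetoid X).comap Subtype.val))) (ξ := ⟨ξ, hnp⟩) hcon
    obtain ⟨η, hηF, hη⟩ := hξ' A hA
    exact hAO η hη hηF

end BlockFiltration

/-! ### Sums of distinct powers of three -/

theorem two_mul_sum_three_pow_lt (S : Finset ℕ) (n : ℕ) (h : ∀ i ∈ S, i < n) :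
    2 * ∑ i ∈ S, (3 : ℝ) ^ i < 3 ^ n := by
  have h1 : ∑ i ∈ S, (3 : ℝ) ^ i ≤ ∑ i ∈ Finset.range n, (3 : ℝ) ^ i :=
    Finset.sum_le_sum_of_subset_of_nonneg (fun i hi => Finset.mem_range.2 (h i hi))
      fun _ _ _ => by positivity
  have h2 := geom_sum_eq (show (3 : ℝ) ≠ 1 by norm_num) n
  rw [h2] at h1
  linarith

theorem sum_three_pow_filter (S : Finset ℕ) (n : ℕ) :
    ∑ i ∈ S, (3 : ℝ) ^ i = ∑ i ∈ S.filter (n ≤ ·), (3 : ℝ) ^ i +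
      ∑ i ∈ S.filter (· < n), (3 : ℝ) ^ i := by
  rw [← Finset.sum_filter_add_sum_filter_not S (n ≤ ·)]
  simp only [not_le]

theorem abs_sum_three_pow_sub_le {S T : Finset ℕ} {n : ℕ}
    (h : S.filter (n ≤ ·) = T.filter (n ≤ ·)) :
    |∑ i ∈ S, (3 : ℝ) ^ i - ∑ i ∈ T, (3 : ℝ) ^ i| ≤ 3 ^ n := by
  rw [sum_three_pow_filter S n, sum_three_pow_filter T n, h, add_sub_add_left_eq_sub]
  have h1 := two_mul_sum_three_pow_lt (S.filter (· < n)) n (by simp)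
  have h2 := two_mul_sum_three_pow_lt (T.filter (· < n)) n (by simp)
  have h3 : 0 ≤ ∑ i ∈ S.filter (· < n), (3 : ℝ) ^ i := by positivity
  have h4 : 0 ≤ ∑ i ∈ T.filter (· < n), (3 : ℝ) ^ i := by positivity
  rw [abs_le]
  constructor <;> linarith

theorem three_pow_le_abs_sum_sub {S T : Finset ℕ} {n : ℕ}
    (h : S.filter (n ≤ ·) ≠ T.filter (n ≤ ·)) :
    3 ^ n ≤ 2 * |∑ i ∈ S, (3 : ℝ) ^ i - ∑ i ∈ T, (3 : ℝ) ^ i| := by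
  -- The largest position `i` at which the two sets differ decides.
  have key : ∀ (S T : Finset ℕ) (i : ℕ), n ≤ i → i ∈ S → i ∉ T →
      (∀ j, i < j → (j ∈ S ↔ j ∈ T)) →
      3 ^ n ≤ 2 * |∑ i ∈ S, (3 : ℝ) ^ i - ∑ i ∈ T, (3 : ℝ) ^ i| := by
    intro S T i hni hS hT hj
    have hST : S.filter (i ≤ ·) = insert i (T.filter (i ≤ ·)) := by
      ext j
      simp only [Finset.mem_filter, Finset.mem_insert]
      rcases lt_trichotomy i j with hij | rfl | hij
      · simp [hj j hij, hij.le, hij.ne']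
      · simp [hS]
      · simp [hij.not_ge, hij.ne]
    have hi : i ∉ T.filter (i ≤ ·) := fun h => hT (Finset.mem_filter.1 h).1
    rw [sum_three_pow_filter S i, sum_three_pow_filter T i, hST, Finset.sum_insert hi]
    have h2 := two_mul_sum_three_pow_lt (T.filter (· < i)) i (by simp)
    have h3 : 0 ≤ ∑ i ∈ S.filter (· < i), (3 : ℝ) ^ i := by positivity
    have h4 : (3 : ℝ) ^ n ≤ 3 ^ i := pow_le_pow_right₀ (by norm_num) hni
    refine le_trans ?_ (mul_le_mul_of_nonneg_left (le_abs_self _) zero_le_two)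
    linarith
  obtain ⟨a, ha⟩ : ((symmDiff S T).filter (n ≤ ·)).Nonempty := by
    rw [Finset.nonempty_iff_ne_empty]
    intro h0
    refine h (Finset.ext fun i => ?_)
    have := Finset.ext_iff.1 h0 i
    simp only [Finset.mem_filter, Finset.mem_symmDiff, Finset.notMem_empty, iff_false] at this ⊢
    tauto
  have hmem := Finset.max'_mem _ ⟨a, ha⟩
  have hmax : ∀ j, ((symmDiff S T).filter (n ≤ ·)).max' ⟨a, ha⟩ < j → (j ∈ S ↔ j ∈ T) := by
    intro j hj
    by_contra hcon
    have hn : n ≤ j := (Finset.mem_filter.1 hmem).2.trans hj.le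
    refine (Finset.le_max' ((symmDiff S T).filter (n ≤ ·)) j ?_).not_gt hj
    simp only [Finset.mem_filter, Finset.mem_symmDiff]
    tauto
  obtain ⟨hmem, hn⟩ := Finset.mem_filter.1 hmem
  rcases Finset.mem_symmDiff.1 hmem with ⟨hS, hT⟩ | ⟨hT, hS⟩
  · exact key S T _ hn hS hT hmax
  · rw [abs_sub_comm]
    exact key T S _ hn hT hS fun j hj => (hmax j hj).symm

/-! ### The spaces `M_1 ⊔ ⋯ ⊔ M_k` -/

namespace SpaceM

/-- The support of an element of `M`, as a finite set. -/
noncomputable def finsetSupport (a : SpaceM) : Finset ℕ := a.2.toFinset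

theorem dist_eq_finsetSupport (a b : SpaceM) :
    dist a b = 3 * |∑ i ∈ a.finsetSupport, (3 : ℝ) ^ i - ∑ i ∈ b.finsetSupport, (3 : ℝ) ^ i| := by
  rw [dist_eq, value_eq, value_eq]
  push_cast
  rw [← mul_sub, abs_mul, abs_of_nonneg (zero_le_three (α := ℝ))]
  rfl

theorem mem_layersUpTo {k : ℕ} {a : SpaceM} :
    a ∈ layersUpTo k ↔ 1 ≤ a.finsetSupport.card ∧ a.finsetSupport.card ≤ k := by
  have : a.finsetSupport.card = a.support.ncard := (Set.ncard_eq_toFinset_card _ a.2).symm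
  simp [layersUpTo, layer, this]

open Classical in
/-- The element of `M` with a given support. -/
noncomputable def ofFinset (S : Finset ℕ) : SpaceM :=
  ⟨fun i => if i ∈ S then 1 else 0, S.finite_toSet.subset fun i hi => by
    by_contra h
    have h' : i ∉ S := h
    simp [h'] at hi⟩

theorem finsetSupport_ofFinset (S : Finset ℕ) : (ofFinset S).finsetSupport = S := by
  ext i
  by_cases h : i ∈ S <;> simp [finsetSupport, ofFinset, h]

theorem uniformlyLocallyFinite_layersUpTo (k : ℕ) : UniformlyLocallyFinite (layersUpTo k) := by
  intro r
  obtain ⟨R, hR⟩ := exists_nat_ge r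
  refine ⟨2 * R + 1, fun x => ?_⟩
  have hinj : Function.Injective fun y : layersUpTo k => y.1.value :=
    value_injective.comp Subtype.val_injective
  rw [← hinj.encard_image]
  have hsub : (fun y : layersUpTo k => y.1.value) '' Metric.closedBall x r ⊆
      (Finset.Icc (x.1.value - R) (x.1.value + R) : Finset ℕ) := by
    rintro _ ⟨y, hy, rfl⟩
    have h : |(y.1.value : ℝ) - x.1.value| ≤ R := (Metric.mem_closedBall.1 hy).trans hR
    rw [abs_le] at h
    have h1 : (x.1.value : ℝ) ≤ y.1.value + R := by linarith
    have h2 : (y.1.value : ℝ) ≤ x.1.value + R := by linarith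
    have h1' : x.1.value ≤ y.1.value + R := by exact_mod_cast h1
    have h2' : y.1.value ≤ x.1.value + R := by exact_mod_cast h2
    simp only [Finset.coe_Icc, Set.mem_Icc]
    omega
  refine (Set.encard_le_encard hsub).trans ?_
  rw [Set.encard_coe_eq_coe_finsetCard, Nat.card_Icc]
  norm_cast
  omega

end SpaceM

theorem IsCoarseEmbedding.exists_dist_le {X Y : Type*} [MetricSpace X] [MetricSpace Y] {f : X → Y}
    (hf : IsCoarseEmbedding f) (r : ℝ) :
    (∃ s : ℝ, ∀ x y, dist x y ≤ r → dist (f x) (f y) ≤ s) ∧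
      ∃ s : ℝ, ∀ x y, dist (f x) (f y) ≤ r → dist x y ≤ s := by
  have hbdd : ∀ {u : ℕ → ℝ}, (∀ n, u n ≤ r) → ¬ Tendsto u atTop atTop := fun {u} hu h => by
    obtain ⟨n, hn⟩ := (h.eventually (eventually_gt_atTop r)).exists
    exact hn.not_ge (hu n)
  constructor
  · by_contra! hcon
    choose x y hxy hlt using fun n : ℕ => hcon n
    exact hbdd hxy ((hf x y).2 (tendsto_atTop_mono (fun n => (hlt n).le)
      tendsto_natCast_atTop_atTop))
  · by_contra! hcon
    choose x y hxy hlt using fun n : ℕ => hcon n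
    exact hbdd hxy ((hf x y).1 (tendsto_atTop_mono (fun n => (hlt n).le)
      tendsto_natCast_atTop_atTop))

/-- A space that coarsely embeds into `M_1 ⊔ ⋯ ⊔ M_k` is filtered by the relations “the supports of
the images agree from `n` on”. -/
noncomputable def IsCoarseEmbedding.blockFiltration {X : Type*} [MetricSpace X] {k : ℕ}
    {f : X → SpaceM.layersUpTo k} (hf : IsCoarseEmbedding f) : BlockFiltration X where
  rel n := Setoid.ker fun x => (f x).1.finsetSupport.filter (n ≤ ·)
  mono m n hmn x y hxy := by
    rw [Setoid.ker_def] at hxy ⊢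
    ext i
    have := Finset.ext_iff.1 hxy i
    simp only [Finset.mem_filter] at this ⊢
    constructor
    · exact fun h => ⟨(this.1 ⟨h.1, hmn.trans h.2⟩).1, h.2⟩
    · exact fun h => ⟨(this.2 ⟨h.1, hmn.trans h.2⟩).1, h.2⟩
  exists_rel_of_dist_le r := by
    obtain ⟨s, hs⟩ := (hf.exists_dist_le r).1
    obtain ⟨n, hn⟩ := pow_unbounded_of_one_lt s (show (1 : ℝ) < 3 by norm_num)
    refine ⟨n, fun x y hxy => ?_⟩
    rw [Setoid.ker_def]
    by_contra hne
    have h1 := three_pow_le_abs_sum_sub hne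
    have h2 := hs x y hxy
    rw [Subtype.dist_eq, SpaceM.dist_eq_finsetSupport] at h2
    have h3 := abs_nonneg (∑ i ∈ (f x).1.finsetSupport, (3 : ℝ) ^ i -
      ∑ i ∈ (f y).1.finsetSupport, (3 : ℝ) ^ i)
    linarith
  exists_dist_le_of_rel n := by
    obtain ⟨s, hs⟩ := (hf.exists_dist_le (3 * 3 ^ n)).2
    refine ⟨s, fun x y hxy => hs x y ?_⟩
    rw [Setoid.ker_def] at hxy
    rw [Subtype.dist_eq, SpaceM.dist_eq_finsetSupport]
    exact mul_le_mul_of_nonneg_left (abs_sum_three_pow_sub_le hxy) (by norm_num)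

theorem IsCoarseEmbedding.isTailFiltration {X : Type*} [MetricSpace X] {k : ℕ}
    {f : X → SpaceM.layersUpTo k} (hf : IsCoarseEmbedding f) :
    hf.blockFiltration.IsTailFiltration k fun x => (f x).1.finsetSupport :=
  ⟨fun x => (SpaceM.mem_layersUpTo.1 (f x).2).2, fun _ _ _ => Iff.rfl⟩

/-- Let `p` be a free ultrafilter on `ℕ`. The orbit of the limit of the points `{l}` along `l → p`
contains the limits of `{m, l}` along `l → p` for each `m`, but not their limit along `m → p`: the
latter ultrafilter contains the sets of those `{m, l}` with both entries beyond any given bound. -/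
theorem not_t1Space_orbitSpace_layersUpTo {k : ℕ} (hk : 2 ≤ k) :
    ¬ T1Space (OrbitSpace (SpaceM.layersUpTo k)) := by
  intro hT1
  have hid : IsCoarseEmbedding (id : SpaceM.layersUpTo k → SpaceM.layersUpTo k) :=
    fun _ _ => Iff.rfl
  set E := hid.blockFiltration
  have hrel : ∀ n x y, E.rel n x y ↔
      x.1.finsetSupport.filter (n ≤ ·) = y.1.finsetSupport.filter (n ≤ ·) := fun _ _ _ => Iff.rfl
  have hX := SpaceM.uniformlyLocallyFinite_layersUpTo k
  let pt : ℕ → ℕ → SpaceM.layersUpTo k := fun m l => ⟨SpaceM.ofFinset {m, l}, by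
    rw [SpaceM.mem_layersUpTo, SpaceM.finsetSupport_ofFinset]
    exact ⟨Finset.card_pos.2 ⟨m, by simp⟩, Finset.card_le_two.trans hk⟩⟩
  have hpt : ∀ m l, (pt m l).1.finsetSupport = {m, l} := fun m l =>
    SpaceM.finsetSupport_ofFinset _
  set p : Ultrafilter ℕ := hyperfilter ℕ
  have hp : ∀ n, ∀ᶠ l in (p : Filter ℕ), n < l := fun n =>
    (Nat.hyperfilter_le_atTop) (eventually_gt_atTop n)
  have hfar : ∀ x : SpaceM.layersUpTo k, ∃ n, ∀ l, n < l → ∀ m, pt m l ≠ x := by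
    intro x
    obtain ⟨n, hn⟩ := x.1.finsetSupport.bddAbove
    refine ⟨n, fun l hl m h => hl.not_ge (hn ?_)⟩
    rw [← h, hpt]
    simp
  let ξ : Ultrafilter (SpaceM.layersUpTo k) := p.map fun l => pt l l
  have hξ : ∀ x, ξ ≠ pure x := by
    intro x hx
    obtain ⟨n, hn⟩ := hfar x
    have h1 : {x} ∈ ξ := hx ▸ Ultrafilter.mem_pure.2 rfl
    obtain ⟨l, hl, hl'⟩ := ((hp n).and (Ultrafilter.mem_map.1 h1)).exists
    exact hn l hl l hl'
  -- the iterated limit of the points `{m, l}`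
  let G : Filter (SpaceM.layersUpTo k) :=
    ((p : Filter ℕ).bind fun m => (p : Filter ℕ).map (pt m))
  have hG : ∀ A, A ∈ G ↔ ∀ᶠ m in (p : Filter ℕ), ∀ᶠ l in (p : Filter ℕ), pt m l ∈ A :=
    fun A => Filter.mem_bind'
  have hGne : G.NeBot := ⟨fun h => by
    have : (∅ : Set (SpaceM.layersUpTo k)) ∈ G := h ▸ mem_bot
    exact p.neBot.ne (by simpa [hG] using this)⟩
  let η := Ultrafilter.of G
  have hη : ∀ n A, (∀ m l, n < m → m < l → pt m l ∉ A) → A ∉ η := by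
    intro n A hA hAη
    refine (Ultrafilter.compl_mem_iff_notMem.1 (Ultrafilter.of_le G ?_)) hAη
    rw [hG]
    exact (hp n).mono fun m hm => (hp m).mono fun l hl => hA m l hm hl
  have hηnp : ∀ x, η ≠ pure x := by
    intro x hx
    obtain ⟨n, hn⟩ := hfar x
    exact hη n {x} (fun m l hm hl h => hn l (hm.trans hl) m h) (hx ▸ Ultrafilter.mem_pure.2 rfl)
  have hclosed : IsClosed (orbitMk ⁻¹' {orbitMk ⟨ξ, hξ⟩}) :=
    isClosed_singleton.preimage (continuous_quotient_mk'
      (s := (orbitSetoid (SpaceM.layersUpTo k)).comap Subtype.val))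
  have hmem : orbitMk ⟨η, hηnp⟩ = orbitMk ⟨ξ, hξ⟩ := by
    by_contra hcon
    obtain ⟨A, hA, hAO⟩ := exists_subset_of_isOpen_boundary hclosed.isOpen_compl
      (ξ := ⟨η, hηnp⟩) hcon
    have hAG : Aᶜ ∉ G := fun h => Ultrafilter.compl_mem_iff_notMem.1 (Ultrafilter.of_le G h) hA
    rw [hG] at hAG
    obtain ⟨m, hm⟩ := (not_eventually.1 hAG).exists
    have hm' : ∀ᶠ l in (p : Filter ℕ), pt m l ∈ A := by
      simpa using Ultrafilter.eventually_not.2 hm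
    have hsat : E.sat (m + 1) A ∈ ξ := by
      refine Ultrafilter.mem_map.2 (hm'.mono fun l hl => ⟨pt m l, hl, ?_⟩)
      rw [hrel, hpt, hpt]
      ext i
      simp only [Finset.mem_filter, Finset.mem_insert, Finset.mem_singleton]
      omega
    obtain ⟨ζ, hζA, hζ⟩ := (E.exists_orbitMk_eq_iff hX ⟨ξ, hξ⟩).2 ⟨_, hsat⟩
    exact hAO ζ hζA hζ
  obtain ⟨n, hn⟩ := (E.exists_orbitMk_eq_iff hX (A := Set.range fun l => pt l l) ⟨η, hηnp⟩).1
    ⟨⟨ξ, hξ⟩, Ultrafilter.mem_map.2 (Eventually.of_forall fun l => ⟨l, rfl⟩), hmem.symm⟩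
  refine hη n _ ?_ hn
  rintro m l hm hl ⟨_, ⟨j, rfl⟩, h⟩
  rw [hrel, hpt, hpt] at h
  have h1 := Finset.ext_iff.1 h m
  have h2 := Finset.ext_iff.1 h l
  simp only [Finset.mem_filter, Finset.mem_insert, Finset.mem_singleton, true_or, or_true, true_and,
    or_self] at h1 h2
  omega

/-! ### Operators on `ℓ₂(X)` -/

section EllTwo

variable {X : Type*}

theorem EllTwo.sum_norm_sq_le (φ : EllTwo X) (s : Finset X) :
    ∑ x ∈ s, ‖φ x‖ ^ 2 ≤ ‖φ‖ ^ 2 := by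
  simpa using lp.sum_rpow_le_norm_rpow (p := 2) (by norm_num) φ s

theorem EllTwo.norm_le_of_sum_le {φ : EllTwo X} {C : ℝ} (hC : 0 ≤ C)
    (h : ∀ s : Finset X, ∑ x ∈ s, ‖φ x‖ ^ 2 ≤ C ^ 2) : ‖φ‖ ≤ C :=
  lp.norm_le_of_forall_sum_le (by norm_num) hC (by simpa using h)

open Classical in
theorem EllTwo.inner_single_one_left (x : X) (φ : EllTwo X) :
    inner ℂ (lp.single 2 x (1 : ℂ) : EllTwo X) φ = φ x := by
  rw [lp.inner_single_left]
  simp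

open Classical in
theorem EllTwo.ext_single {a b : EllTwo X →L[ℂ] EllTwo X}
    (h : ∀ x, a (lp.single 2 x (1 : ℂ)) = b (lp.single 2 x (1 : ℂ))) : a = b := by
  refine lp.ext_continuousLinearMap (by norm_num) fun x => ?_
  refine ContinuousLinearMap.ext_ring ?_
  exact h x

namespace PEquiv

theorem partialIsometry_apply (f : X ≃. X) (φ : EllTwo X) (y : X) :
    f.partialIsometry φ y = (f.symm y).elim 0 φ := rfl

theorem partialIsometry_apply_of_eq_some {f : X ≃. X} (φ : EllTwo X) {x y : X} (h : f x = some y) :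
    f.partialIsometry φ y = φ x := by
  rw [partialIsometry_apply, f.eq_some_iff.2 h]
  rfl

theorem partialIsometry_apply_eq_zero {f : X ≃. X} (φ : EllTwo X) {y : X}
    (h : ∀ x, f x ≠ some y) : f.partialIsometry φ y = 0 := by
  rw [partialIsometry_apply]
  have : f.symm y = none := by
    rw [Option.eq_none_iff_forall_ne_some]
    exact fun x hx => h x (f.eq_some_iff.1 hx)
  rw [this]
  rfl

theorem partialIsometry_trans (f g : X ≃. X) :
    (f.trans g).partialIsometry = g.partialIsometry * f.partialIsometry := by
  ext φ y
  change ((f.trans g).symm y).elim 0 φ = (g.symm y).elim 0 (f.partialIsometry φ)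
  rw [PEquiv.symm_trans_rev]
  change ((g.symm y).bind f.symm).elim 0 φ = _
  cases g.symm y <;> rfl

theorem star_partialIsometry (f : X ≃. X) : star f.partialIsometry = f.symm.partialIsometry := by
  classical
  ext φ x
  rw [← EllTwo.inner_single_one_left, ContinuousLinearMap.star_eq_adjoint,
    ContinuousLinearMap.adjoint_inner_right]
  rcases h : f x with _ | y
  · rw [f.partialIsometry_single_of_eq_none h, inner_zero_left, partialIsometry_apply,
      PEquiv.symm_symm, h]
    rfl
  · rw [f.partialIsometry_single_of_eq_some h, EllTwo.inner_single_one_left,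
      partialIsometry_apply, PEquiv.symm_symm, h]
    rfl

end PEquiv

open Classical in
/-- The orthogonal projection of `ℓ₂(X)` onto `ℓ₂(T)`. -/
noncomputable def projOp (T : Set X) : EllTwo X →L[ℂ] EllTwo X := (PEquiv.ofSet T).partialIsometry

open Classical in
theorem projOp_apply (T : Set X) (φ : EllTwo X) (x : X) :
    projOp T φ x = if x ∈ T then φ x else 0 := by
  by_cases h : x ∈ T
  · rw [if_pos h]
    exact PEquiv.partialIsometry_apply_of_eq_some φ (PEquiv.ofSet_eq_some_self_iff.2 h)
  · rw [if_neg h]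
    refine PEquiv.partialIsometry_apply_eq_zero φ fun y hy => h ?_
    obtain ⟨rfl, hx⟩ := PEquiv.ofSet_eq_some_iff.1 hy
    exact hx

theorem projOp_apply_of_mem {T : Set X} (φ : EllTwo X) {x : X} (h : x ∈ T) :
    projOp T φ x = φ x := by rw [projOp_apply, if_pos h]

theorem projOp_apply_of_notMem {T : Set X} (φ : EllTwo X) {x : X} (h : x ∉ T) :
    projOp T φ x = 0 := by rw [projOp_apply, if_neg h]

theorem star_projOp (T : Set X) : star (projOp T) = projOp T := by
  rw [projOp, PEquiv.star_partialIsometry, PEquiv.ofSet_symm]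

theorem projOp_mul_projOp (S T : Set X) : projOp S * projOp T = projOp (S ∩ T) := by
  ext φ x
  change projOp S (projOp T φ) x = _
  simp only [projOp_apply, Set.mem_inter_iff]
  by_cases h : x ∈ S <;> by_cases h' : x ∈ T <;> simp [h, h']

theorem projOp_empty : projOp (∅ : Set X) = 0 := by
  ext φ x
  rw [projOp_apply_of_notMem _ (Set.notMem_empty x)]
  rfl

theorem projOp_univ : projOp (Set.univ : Set X) = 1 := by
  ext φ x
  rw [projOp_apply_of_mem _ (Set.mem_univ x)]
  rfl

theorem projOp_union {S T : Set X} (h : Disjoint S T) :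
    projOp (S ∪ T) = projOp S + projOp T := by
  ext φ x
  change _ = projOp S φ x + projOp T φ x
  by_cases hS : x ∈ S
  · rw [projOp_apply_of_mem _ hS, projOp_apply_of_mem _ (Set.mem_union_left T hS),
      projOp_apply_of_notMem _ (Set.disjoint_left.1 h hS), add_zero]
  · rw [projOp_apply_of_notMem _ hS, zero_add]
    by_cases hT : x ∈ T
    · rw [projOp_apply_of_mem _ hT, projOp_apply_of_mem _ (Set.mem_union_right S hT)]
    · rw [projOp_apply_of_notMem _ hT, projOp_apply_of_notMem _ fun h' => h'.elim hS hT]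

theorem inner_projOp_projOp {S T : Set X} (h : Disjoint S T) (φ ψ : EllTwo X) :
    inner ℂ (projOp S φ) (projOp T ψ) = 0 := by
  rw [← star_projOp S, ContinuousLinearMap.star_eq_adjoint,
    ContinuousLinearMap.adjoint_inner_left]
  change inner ℂ φ ((projOp S * projOp T) ψ) = 0
  rw [projOp_mul_projOp, h.inter_eq, projOp_empty]
  simp

theorem norm_sq_projOp_union {S T : Set X} (h : Disjoint S T) (φ : EllTwo X) :
    ‖projOp (S ∪ T) φ‖ ^ 2 = ‖projOp S φ‖ ^ 2 + ‖projOp T φ‖ ^ 2 := by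
  rw [projOp_union h, add_apply, sq, sq, sq]
  exact norm_add_sq_eq_norm_sq_add_norm_sq_of_inner_eq_zero _ _ (inner_projOp_projOp h φ φ)

theorem norm_projOp_apply_le (T : Set X) (φ : EllTwo X) : ‖projOp T φ‖ ≤ ‖φ‖ := by
  refine EllTwo.norm_le_of_sum_le (norm_nonneg _) fun s =>
    (Finset.sum_le_sum fun x _ => ?_).trans (φ.sum_norm_sq_le s)
  rw [projOp_apply]
  split_ifs
  · exact le_rfl
  · simp

theorem norm_projOp_le (T : Set X) : ‖projOp T‖ ≤ 1 :=
  ContinuousLinearMap.opNorm_le_bound _ zero_le_one fun φ => by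
    rw [one_mul]
    exact norm_projOp_apply_le T φ

/-- Multiplication by a bounded function `g`, as an operator on `ℓ₂(X)`. -/
noncomputable def diagOp (g : X → ℂ) (C : ℝ) (hg : ∀ x, ‖g x‖ ≤ C) : EllTwo X →L[ℂ] EllTwo X :=
  have key : ∀ (φ : EllTwo X) (s : Finset X),
      ∑ x ∈ s, ‖g x * φ x‖ ^ (2 : ℝ≥0∞).toReal ≤ (|C| * ‖φ‖) ^ (2 : ℝ≥0∞).toReal := fun φ s => by
    have := mul_le_mul_of_nonneg_left (φ.sum_norm_sq_le s) (sq_nonneg |C|)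
    rw [Finset.mul_sum] at this
    simp only [ENNReal.toReal_ofNat, Real.rpow_ofNat, norm_mul, mul_pow]
    refine (Finset.sum_le_sum fun x _ => ?_).trans this
    have h := (hg x).trans (le_abs_self C)
    gcongr
  LinearMap.mkContinuous
    { toFun := fun φ => ⟨fun x => g x * φ x, memℓp_gen' (key φ)⟩
      map_add' := fun φ ψ => by
        ext x
        exact mul_add _ _ _
      map_smul' := fun c φ => by
        ext x
        exact mul_left_comm _ _ _ }
    |C| (fun φ => lp.norm_le_of_forall_sum_le (by norm_num) (by positivity) (key φ))

theorem diagOp_apply (g : X → ℂ) (C : ℝ) (hg : ∀ x, ‖g x‖ ≤ C) (φ : EllTwo X) (x : X) :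
    diagOp g C hg φ x = g x * φ x := rfl

theorem norm_diagOp_le (g : X → ℂ) {C : ℝ} (hg : ∀ x, ‖g x‖ ≤ C) (hC : 0 ≤ C) :
    ‖diagOp g C hg‖ ≤ C := by
  refine ContinuousLinearMap.opNorm_le_bound _ hC fun φ =>
    EllTwo.norm_le_of_sum_le (by positivity) fun s => ?_
  have := mul_le_mul_of_nonneg_left (φ.sum_norm_sq_le s) (sq_nonneg C)
  rw [Finset.mul_sum] at this
  rw [mul_pow]
  refine (Finset.sum_le_sum fun x _ => ?_).trans this
  rw [diagOp_apply, norm_mul, mul_pow]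
  gcongr
  exact hg x

end EllTwo

/-! ### The uniform Roe algebra -/

section UniformRoeAlgebra

variable {X : Type*} [MetricSpace X]

instance uniformRoeAlgebra.isClosed :
    IsClosed (uniformRoeAlgebra X : Set (EllTwo X →L[ℂ] EllTwo X)) :=
  StarSubalgebra.isClosed_topologicalClosure _

noncomputable instance uniformRoeAlgebra.cstarAlgebra : CStarAlgebra (uniformRoeAlgebra X) :=
  StarSubalgebra.cstarAlgebra _

theorem partialIsometry_mem {f : X ≃. X} (hf : f ∈ partialTranslations X) :
    f.partialIsometry ∈ uniformRoeAlgebra X :=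
  StarSubalgebra.le_topologicalClosure _ (StarAlgebra.subset_adjoin ℂ _ ⟨f, hf, rfl⟩)

theorem symm_mem_partialTranslations {f : X ≃. X} (hf : f ∈ partialTranslations X) :
    f.symm ∈ partialTranslations X := by
  obtain ⟨r, hr⟩ := hf
  exact ⟨r, fun x y h => dist_comm x y ▸ hr y x (f.eq_some_iff.1 h)⟩

theorem trans_mem_partialTranslations {f g : X ≃. X} (hf : f ∈ partialTranslations X)
    (hg : g ∈ partialTranslations X) : f.trans g ∈ partialTranslations X := by
  obtain ⟨r, hr⟩ := hf
  obtain ⟨s, hs⟩ := hg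
  refine ⟨r + s, fun x z h => ?_⟩
  obtain ⟨y, hy, hz⟩ := (PEquiv.trans_eq_some f g x z).1 h
  exact (dist_triangle x y z).trans (add_le_add (hr x y hy) (hs y z hz))

open Classical in
theorem ofSet_mem_partialTranslations (T : Set X) : PEquiv.ofSet T ∈ partialTranslations X := by
  refine ⟨0, fun x y h => ?_⟩
  obtain ⟨rfl, -⟩ := PEquiv.ofSet_eq_some_iff.1 h
  simp

theorem projOp_mem (T : Set X) : projOp T ∈ uniformRoeAlgebra X :=
  partialIsometry_mem (ofSet_mem_partialTranslations T)

/-- The partial isometries of partial translations are closed under products and adjoints, so that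
their linear span is dense in the uniform Roe algebra. -/
theorem mem_closure_span {a : EllTwo X →L[ℂ] EllTwo X} (ha : a ∈ uniformRoeAlgebra X) :
    a ∈ closure (Submodule.span ℂ (PEquiv.partialIsometry '' partialTranslations X) :
      Set (EllTwo X →L[ℂ] EllTwo X)) := by
  refine closure_mono ?_ ha
  intro b hb
  induction hb using StarAlgebra.adjoin_induction with
  | mem x h => exact Submodule.subset_span h
  | algebraMap r =>
    rw [Algebra.algebraMap_eq_smul_one, ← projOp_univ]
    exact Submodule.smul_mem _ _
      (Submodule.subset_span ⟨_, ofSet_mem_partialTranslations _, rfl⟩)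
  | add x y _ _ hx hy => exact Submodule.add_mem _ hx hy
  | mul x y _ _ hx hy =>
    refine Submodule.span_induction₂ (p := fun x y _ _ => x * y ∈ Submodule.span ℂ
      (PEquiv.partialIsometry '' partialTranslations X)) ?_ ?_ ?_ ?_ ?_ ?_ ?_ hx hy
    · rintro _ _ ⟨f, hf, rfl⟩ ⟨g, hg, rfl⟩
      rw [← PEquiv.partialIsometry_trans]
      exact Submodule.subset_span ⟨_, trans_mem_partialTranslations hg hf, rfl⟩
    · simp
    · simp
    · intro x y z _ _ _ h h'
      rw [add_mul]
      exact Submodule.add_mem _ h h'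
    · intro x y z _ _ _ h h'
      rw [mul_add]
      exact Submodule.add_mem _ h h'
    · intro r x y _ _ h
      rw [smul_mul_assoc]
      exact Submodule.smul_mem _ _ h
    · intro r x y _ _ h
      rw [mul_smul_comm]
      exact Submodule.smul_mem _ _ h
  | star x _ hx =>
    refine Submodule.span_induction (p := fun x _ => star x ∈ Submodule.span ℂ
      (PEquiv.partialIsometry '' partialTranslations X)) ?_ ?_ ?_ ?_ hx
    · rintro _ ⟨f, hf, rfl⟩
      rw [PEquiv.star_partialIsometry]
      exact Submodule.subset_span ⟨_, symm_mem_partialTranslations hf, rfl⟩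
    · simp
    · intro x y _ _ h h'
      rw [star_add]
      exact Submodule.add_mem _ h h'
    · intro r x _ h
      rw [star_smul]
      exact Submodule.smul_mem _ _ h

/-- The partial isometry of a partial translation, as an element of the uniform Roe algebra. -/
noncomputable def roeShift {f : X ≃. X} (hf : f ∈ partialTranslations X) : uniformRoeAlgebra X :=
  ⟨f.partialIsometry, partialIsometry_mem hf⟩

/-- The projection onto `ℓ₂(T)`, as an element of the uniform Roe algebra. -/
noncomputable def roeProj (T : Set X) : uniformRoeAlgebra X := ⟨projOp T, projOp_mem T⟩

theorem roeProj_mul_roeProj (S T : Set X) :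
    roeProj S * roeProj T = roeProj (S ∩ T) := Subtype.ext (projOp_mul_projOp S T)

theorem roeProj_empty : roeProj (∅ : Set X) = 0 := Subtype.ext projOp_empty

theorem roeProj_univ : roeProj (Set.univ : Set X) = 1 := Subtype.ext projOp_univ

theorem roeProj_union {S T : Set X} (h : Disjoint S T) :
    roeProj (S ∪ T) = roeProj S + roeProj T := Subtype.ext (projOp_union h)

theorem norm_roeProj_le (T : Set X) : ‖roeProj T‖ ≤ 1 := norm_projOp_le T

/-- To prove a closed property of the elements of the uniform Roe algebra, it suffices to check the
partial isometries and linear combinations. -/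
theorem uniformRoeAlgebra_induction {p : uniformRoeAlgebra X → Prop} (hp : IsClosed {a | p a})
    (hshift : ∀ f (hf : f ∈ partialTranslations X), p (roeShift hf)) (hzero : p 0)
    (hadd : ∀ a b, p a → p b → p (a + b)) (hsmul : ∀ (c : ℂ) a, p a → p (c • a))
    (a : uniformRoeAlgebra X) : p a := by
  have hspan : ∀ b ∈ Submodule.span ℂ (PEquiv.partialIsometry '' partialTranslations X),
      ∃ h : b ∈ uniformRoeAlgebra X, p ⟨b, h⟩ := by
    intro b hb
    induction hb using Submodule.span_induction with
    | mem x h =>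
      obtain ⟨f, hf, rfl⟩ := h
      exact ⟨_, hshift f hf⟩
    | zero => exact ⟨zero_mem _, hzero⟩
    | add x y _ _ hx hy =>
      obtain ⟨hx, hx'⟩ := hx
      obtain ⟨hy, hy'⟩ := hy
      exact ⟨add_mem hx hy, hadd _ _ hx' hy'⟩
    | smul c x _ hx =>
      obtain ⟨hx, hx'⟩ := hx
      exact ⟨SMulMemClass.smul_mem c hx, hsmul c _ hx'⟩
  have ha : a ∈ closure {b : uniformRoeAlgebra X | p b} := by
    rw [closure_subtype]
    refine closure_mono ?_ (mem_closure_span a.2)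
    intro b hb
    obtain ⟨h, hb⟩ := hspan b hb
    exact ⟨⟨b, h⟩, hb, rfl⟩
  rwa [hp.closure_eq] at ha

end UniformRoeAlgebra

/-! ### Block diagonal operators -/

namespace BlockFiltration

variable {X : Type*} [MetricSpace X] (E : BlockFiltration X)

/-- The `n`-block of `x`. -/
def block (n : ℕ) (x : X) : Set X := {y | E.rel n y x}

theorem isSaturated_block (n : ℕ) (x : X) : E.IsSaturated n (E.block n x) :=
  fun _ _ hyz hy => (E.rel n).trans ((E.rel n).symm hyz) hy

/-- An operator is block diagonal at level `n` if it commutes with the projections that belong to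
unions of `n`-blocks. -/
def IsBlockDiagonal (n : ℕ) (b : EllTwo X →L[ℂ] EllTwo X) : Prop :=
  ∀ T, E.IsSaturated n T → projOp T * b = b * projOp T

variable {E}

theorem IsBlockDiagonal.mono {m n : ℕ} (h : m ≤ n) {b : EllTwo X →L[ℂ] EllTwo X}
    (hb : E.IsBlockDiagonal m b) : E.IsBlockDiagonal n b := fun T hT => hb T (hT.anti h)

theorem IsBlockDiagonal.add {n : ℕ} {a b : EllTwo X →L[ℂ] EllTwo X} (ha : E.IsBlockDiagonal n a)
    (hb : E.IsBlockDiagonal n b) : E.IsBlockDiagonal n (a + b) := fun T hT => by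
  rw [mul_add, add_mul, ha T hT, hb T hT]

theorem IsBlockDiagonal.smul {n : ℕ} {b : EllTwo X →L[ℂ] EllTwo X} (c : ℂ)
    (hb : E.IsBlockDiagonal n b) : E.IsBlockDiagonal n (c • b) := fun T hT => by
  rw [mul_smul_comm, smul_mul_assoc, hb T hT]

theorem IsBlockDiagonal.mul {n : ℕ} {a b : EllTwo X →L[ℂ] EllTwo X} (ha : E.IsBlockDiagonal n a)
    (hb : E.IsBlockDiagonal n b) : E.IsBlockDiagonal n (a * b) := fun T hT => by
  rw [← mul_assoc, ha T hT, mul_assoc, hb T hT, mul_assoc]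

theorem isBlockDiagonal_projOp (n : ℕ) (S : Set X) : E.IsBlockDiagonal n (projOp S) := fun T _ => by
  rw [projOp_mul_projOp, projOp_mul_projOp, Set.inter_comm]

theorem isBlockDiagonal_partialIsometry {n : ℕ} {f : X ≃. X}
    (hf : ∀ x y, f x = some y → E.rel n x y) : E.IsBlockDiagonal n f.partialIsometry := by
  intro T hT
  ext φ y
  change projOp T (f.partialIsometry φ) y = f.partialIsometry (projOp T φ) y
  rcases h : f.symm y with _ | x
  · have h0 : ∀ x, f x ≠ some y := fun x hx => by
      rw [f.eq_some_iff.2 hx] at h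
      cases h
    rw [PEquiv.partialIsometry_apply_eq_zero _ h0, projOp_apply,
      PEquiv.partialIsometry_apply_eq_zero _ h0, ite_self]
  · have hx := f.eq_some_iff.1 h
    rw [PEquiv.partialIsometry_apply_of_eq_some _ hx, projOp_apply,
      PEquiv.partialIsometry_apply_of_eq_some _ hx]
    have hiff : y ∈ T ↔ x ∈ T :=
      ⟨hT y x ((E.rel n).symm (hf x y hx)), hT x y (hf x y hx)⟩
    by_cases hy : y ∈ T
    · rw [if_pos hy, projOp_apply_of_mem _ (hiff.1 hy)]
    · rw [if_neg hy, projOp_apply_of_notMem _ (mt hiff.2 hy)]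

variable (E)

/-- Block diagonal operators are dense in the uniform Roe algebra. -/
theorem dense_isBlockDiagonal (a : uniformRoeAlgebra X) :
    a ∈ closure {b : uniformRoeAlgebra X | ∃ n, E.IsBlockDiagonal n b.1} := by
  refine uniformRoeAlgebra_induction (p := fun a => a ∈ closure
    {b : uniformRoeAlgebra X | ∃ n, E.IsBlockDiagonal n b.1}) isClosed_closure ?_ ?_ ?_ ?_ a
  · intro f hf
    obtain ⟨n, hn⟩ := E.exists_rel_of_mem_partialTranslations hf
    exact subset_closure ⟨n, isBlockDiagonal_partialIsometry hn⟩
  · exact subset_closure ⟨0, fun T _ => by simp⟩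
  · intro a b ha hb
    refine map_mem_closure₂ continuous_add ha hb ?_
    rintro a ⟨m, hm⟩ b ⟨n, hn⟩
    exact ⟨max m n, (hm.mono (le_max_left _ _)).add (hn.mono (le_max_right _ _))⟩
  · intro c a ha
    refine map_mem_closure (continuous_const_smul c) ha ?_
    rintro a ⟨n, hn⟩
    exact ⟨n, hn.smul c⟩

variable {E}

/-- The norm of a block diagonal operator is determined blockwise. -/
theorem IsBlockDiagonal.norm_apply_le {n : ℕ} {b : EllTwo X →L[ℂ] EllTwo X}
    (hb : E.IsBlockDiagonal n b) {K : ℝ} (hK : 0 ≤ K)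
    (h : ∀ x φ, projOp (E.block n x) φ = φ → ‖b φ‖ ≤ K * ‖φ‖) (φ : EllTwo X) :
    ‖b φ‖ ≤ K * ‖φ‖ := by
  classical
  have hcomm : ∀ T, E.IsSaturated n T → ∀ φ, projOp T (b φ) = b (projOp T φ) := fun T hT φ =>
    congrArg (fun a : EllTwo X →L[ℂ] EllTwo X => a φ) (hb T hT)
  have key : ∀ G : Finset (Quotient (E.rel n)),
      ‖projOp {x | Quotient.mk _ x ∈ G} (b φ)‖ ^ 2 ≤
        K ^ 2 * ‖projOp {x | Quotient.mk _ x ∈ G} φ‖ ^ 2 := by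
    intro G
    induction G using Finset.induction_on with
    | empty =>
      have : {x : X | Quotient.mk (E.rel n) x ∈ (∅ : Finset (Quotient (E.rel n)))} = ∅ := by
        ext; simp
      rw [this, projOp_empty]
      simp
    | insert q G hq ih =>
      obtain ⟨x, rfl⟩ := q.exists_rep
      have hset : {y : X | Quotient.mk (E.rel n) y ∈ insert (Quotient.mk _ x) G} =
          E.block n x ∪ {y | Quotient.mk _ y ∈ G} := by
        ext y
        rw [Set.mem_ofPred_eq, Finset.mem_insert, Quotient.eq]
        rfl
      have hdisj : Disjoint (E.block n x) {y | Quotient.mk (E.rel n) y ∈ G} := by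
        rw [Set.disjoint_left]
        intro y hy hyG
        rw [Set.mem_ofPred_eq, Quotient.sound (show E.rel n y x from hy)] at hyG
        exact hq hyG
      rw [hset, norm_sq_projOp_union hdisj, norm_sq_projOp_union hdisj, mul_add]
      refine add_le_add ?_ ih
      rw [hcomm _ (E.isSaturated_block n x), ← mul_pow]
      refine pow_le_pow_left₀ (norm_nonneg _) (h x _ ?_) 2
      change (projOp (E.block n x) * projOp (E.block n x)) φ = _
      rw [projOp_mul_projOp, Set.inter_self]
  refine EllTwo.norm_le_of_sum_le (by positivity) fun s => ?_
  set T : Set X := {x | Quotient.mk (E.rel n) x ∈ s.image (Quotient.mk (E.rel n))}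
  calc ∑ x ∈ s, ‖b φ x‖ ^ 2 = ∑ x ∈ s, ‖projOp T (b φ) x‖ ^ 2 := by
        refine Finset.sum_congr rfl fun x hx => ?_
        rw [projOp_apply_of_mem]
        exact Finset.mem_image_of_mem _ hx
    _ ≤ ‖projOp T (b φ)‖ ^ 2 := EllTwo.sum_norm_sq_le _ _
    _ ≤ K ^ 2 * ‖projOp T φ‖ ^ 2 := key _
    _ ≤ (K * ‖φ‖) ^ 2 := by
        rw [mul_pow]
        gcongr
        exact norm_projOp_apply_le T φ

end BlockFiltration

/-! ### Weighted operators in the uniform Roe algebra -/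

section Weighted

variable {X : Type*} [MetricSpace X]

/-- Bounded functions are uniform limits of functions with finitely many values, so that
multiplication by them lies in the uniform Roe algebra. -/
theorem diagOp_mem (g : X → ℂ) (C : ℝ) (hg : ∀ x, ‖g x‖ ≤ C) :
    diagOp g C hg ∈ uniformRoeAlgebra X := by
  classical
  have hclosed : IsClosed (uniformRoeAlgebra X : Set (EllTwo X →L[ℂ] EllTwo X)) := inferInstance
  rw [← SetLike.mem_coe, ← hclosed.closure_eq, Metric.mem_closure_iff]
  intro ε hε
  obtain ⟨t, ht, hcov⟩ := Metric.totallyBounded_iff.1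
    (isCompact_closedBall (0 : ℂ) C).totallyBounded (ε / 2) (half_pos hε)
  have hex : ∀ x, ∃ z ∈ t, dist (g x) z < ε / 2 := fun x => by
    have := hcov (show g x ∈ Metric.closedBall 0 C by simpa using hg x)
    simpa using this
  choose h hht hh using hex
  let b : EllTwo X →L[ℂ] EllTwo X := ∑ z ∈ ht.toFinset, z • projOp (h ⁻¹' {z})
  have hb : ∀ φ x, b φ x = h x * φ x := by
    intro φ x
    have h1 : b φ x = ∑ z ∈ ht.toFinset, z * projOp (h ⁻¹' {z}) φ x := by
      simp only [b, sum_apply, lp.coeFn_sum, Finset.sum_apply]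
      rfl
    rw [h1, Finset.sum_eq_single (h x)]
    · rw [projOp_apply_of_mem _ (show x ∈ h ⁻¹' {h x} from rfl)]
    · intro z _ hz
      rw [projOp_apply_of_notMem _ (show x ∉ h ⁻¹' {z} from fun h' => hz h'.symm), mul_zero]
    · intro hx
      exact absurd (ht.mem_toFinset.2 (hht x)) hx
  refine ⟨b, sum_mem fun z _ => SMulMemClass.smul_mem z (projOp_mem _), ?_⟩
  have hgh : ∀ x, ‖g x - h x‖ ≤ ε / 2 := fun x => (dist_eq_norm (g x) (h x) ▸ hh x).le
  have : diagOp g C hg - b = diagOp (fun x => g x - h x) (ε / 2) hgh := by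
    ext φ x
    change diagOp g C hg φ x - b φ x = _
    rw [hb, diagOp_apply, diagOp_apply, sub_mul]
  rw [dist_eq_norm, this]
  exact (norm_diagOp_le _ hgh (half_pos hε).le).trans_lt (half_lt_self hε)

/-- Let `r` be a map that moves each point within its block. The operator `φ ↦ g · (φ ∘ r)` lies in
the uniform Roe algebra: the points of each colour are moved by a partial translation. -/
theorem BlockFiltration.exists_weighted (E : BlockFiltration X) (hX : UniformlyLocallyFinite X)
    (n : ℕ) (g : X → ℂ) (C : ℝ) (hg : ∀ x, ‖g x‖ ≤ C) (r : X → X) (hr : ∀ x, E.rel n (r x) x) :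
    ∃ V ∈ uniformRoeAlgebra X, ∀ φ x, V φ x = g x * φ (r x) := by
  classical
  obtain ⟨N, c, hc⟩ := E.exists_coloring hX n
  let F : Fin N → X ≃. X := fun i => PEquiv.ofRel (fun x y => r y = x ∧ c y = i)
    (fun x y z ⟨hy, hy'⟩ ⟨hz, hz'⟩ => hc y z
      ((E.rel n).trans ((E.rel n).symm (hr y)) (hy.trans hz.symm ▸ hr z)) (hy'.trans hz'.symm))
    (fun x y z hx hy => hx.1.symm.trans hy.1)
  have hF : ∀ i x y, F i x = some y ↔ r y = x ∧ c y = i := fun i x y => PEquiv.ofRel_eq_some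
  refine ⟨diagOp g C hg * ∑ i, (F i).partialIsometry, mul_mem (diagOp_mem g C hg)
    (sum_mem fun i _ => partialIsometry_mem (E.mem_partialTranslations (n := n) fun x y h => ?_)),
    fun φ x => ?_⟩
  · obtain ⟨rfl, -⟩ := (hF i x y).1 h
    exact hr y
  · change diagOp g C hg ((∑ i, (F i).partialIsometry : EllTwo X →L[ℂ] EllTwo X) φ) x = _
    have h1 : ((∑ i, (F i).partialIsometry : EllTwo X →L[ℂ] EllTwo X) φ) x =
        ∑ i, (F i).partialIsometry φ x := by
      simp only [sum_apply, lp.coeFn_sum, Finset.sum_apply]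
    rw [diagOp_apply, h1, Finset.sum_eq_single (c x)]
    · rw [PEquiv.partialIsometry_apply_of_eq_some φ ((hF _ _ _).2 ⟨rfl, rfl⟩)]
    · intro i _ hi
      exact PEquiv.partialIsometry_apply_eq_zero φ fun y hy => hi ((hF _ _ _).1 hy).2.symm
    · intro h
      exact absurd (Finset.mem_univ _) h

end Weighted

/-! ### Ideals of the uniform Roe algebra -/

/-- An idempotent that is close to an element of an ideal belongs to the ideal. -/
theorem TwoSidedIdeal.mem_of_norm_sub_lt_one {A : Type*} [NormedRing A] [CompleteSpace A]
    (I : TwoSidedIdeal A) {p x : A} (hp : p * p = p) (hx : x ∈ I) (h : ‖p - x‖ < 1) : p ∈ I := by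
  have hu : (Units.oneSub (p - x) h : A) * p = x * p := by
    rw [Units.val_oneSub, sub_mul, sub_mul, hp, one_mul]
    abel
  have : p = ↑(Units.oneSub (p - x) h)⁻¹ * (x * p) := by
    rw [← hu, Units.inv_mul_cancel_left]
  rw [this]
  exact I.mul_mem_left _ _ (I.mul_mem_right _ _ hx)

section Ideals

variable {X : Type*} [MetricSpace X] (I : TwoSidedIdeal (uniformRoeAlgebra X))

theorem roeProj_mem_of_subset {S T : Set X} (hT : roeProj T ∈ I) (h : S ⊆ T) : roeProj S ∈ I := by
  rw [← Set.inter_eq_left.2 h, ← roeProj_mul_roeProj]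
  exact I.mul_mem_left _ _ hT

theorem roeProj_union_mem {S T : Set X} (hS : roeProj S ∈ I) (hT : roeProj T ∈ I) :
    roeProj (S ∪ T) ∈ I := by
  rw [← Set.union_sdiff_self, roeProj_union Set.disjoint_sdiff_right]
  exact I.add_mem hS (roeProj_mem_of_subset I hT Set.sdiff_subset)

theorem roeProj_iUnion_mem {ι : Type*} [Finite ι] {T : ι → Set X} (h : ∀ i, roeProj (T i) ∈ I) :
    roeProj (⋃ i, T i) ∈ I := by
  rw [← Set.biUnion_univ]
  refine Set.Finite.induction_on _ Set.finite_univ ?_ ?_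
  · rw [Set.biUnion_empty, roeProj_empty]
    exact I.zero_mem
  · intro i s _ _ hs
    rw [Set.biUnion_insert]
    exact roeProj_union_mem I (h i) hs

theorem roeProj_sat_mem (E : BlockFiltration X) (hX : UniformlyLocallyFinite X) (n : ℕ) {T : Set X}
    (h : roeProj T ∈ I) : roeProj (E.sat n T) ∈ I := by
  obtain ⟨N, f, hf, hfT, hcov⟩ := E.exists_partialTranslations_cover hX n T
  refine roeProj_mem_of_subset I (roeProj_iUnion_mem I (T := fun i => (f i).domain) fun i => ?_)
    fun x hx => Set.mem_iUnion.2 (hcov x hx)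
  have : roeProj (f i).domain = star (roeShift (hf i)) * roeProj T * roeShift (hf i) := by
    refine Subtype.ext ?_
    change projOp _ = star (f i).partialIsometry * projOp T * (f i).partialIsometry
    rw [PEquiv.star_partialIsometry]
    ext φ x
    change _ = (f i).symm.partialIsometry (projOp T ((f i).partialIsometry φ)) x
    by_cases hx : x ∈ (f i).domain
    · obtain ⟨y, hy⟩ := PEquiv.mem_domain.1 hx
      rw [projOp_apply_of_mem _ hx,
        PEquiv.partialIsometry_apply_of_eq_some _ ((f i).eq_some_iff.2 hy),
        projOp_apply_of_mem _ (hfT i x y hy), PEquiv.partialIsometry_apply_of_eq_some _ hy]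
    · rw [projOp_apply_of_notMem _ hx, PEquiv.partialIsometry_apply_eq_zero]
      exact fun y hy => hx (PEquiv.mem_domain.2 ⟨y, (f i).eq_some_iff.1 hy⟩)
  rw [this]
  exact I.mul_mem_right _ _ (I.mul_mem_left _ _ h)

end Ideals

open Classical in
theorem eq_projOp_of_inner_single {X : Type*} {a : EllTwo X →L[ℂ] EllTwo X} {P : Set X}
    (h : ∀ x y, inner ℂ (a (lp.single 2 x (1 : ℂ))) (a (lp.single 2 y (1 : ℂ))) =
      if x = y ∧ x ∈ P then (1 : ℂ) else 0) : star a * a = projOp P := by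
  refine EllTwo.ext_single fun y => ?_
  ext x
  rw [← EllTwo.inner_single_one_left, mul_apply_eq_comp,
    ContinuousLinearMap.star_eq_adjoint, ContinuousLinearMap.adjoint_inner_right, h, projOp_apply,
    lp.single_apply]
  by_cases hxy : x = y
  · subst hxy
    simp
  · simp [hxy]

section IdealDetermination

variable {X : Type*} [MetricSpace X]

/-- The points of the blocks on which `b` expands some vector by a factor greater than `δ`. -/
def BlockFiltration.expandingSet (E : BlockFiltration X) (n : ℕ) (b : EllTwo X →L[ℂ] EllTwo X)
    (δ : ℝ) : Set X :=
  {x | ∃ φ, projOp (E.block n x) φ = φ ∧ δ * ‖φ‖ < ‖b φ‖}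

theorem BlockFiltration.block_eq_of_rel (E : BlockFiltration X) {n : ℕ} {x y : X}
    (h : E.rel n x y) : E.block n x = E.block n y := by
  ext z
  exact ⟨fun hz => (E.rel n).trans hz h, fun hz => (E.rel n).trans hz ((E.rel n).symm h)⟩

theorem BlockFiltration.isSaturated_expandingSet (E : BlockFiltration X) (n : ℕ)
    (b : EllTwo X →L[ℂ] EllTwo X) (δ : ℝ) : E.IsSaturated n (E.expandingSet n b δ) := by
  rintro x y hxy ⟨φ, hφ, h⟩
  exact ⟨φ, E.block_eq_of_rel hxy ▸ hφ, h⟩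

/-- Choose in each block of `expandingSet n b δ` a vector that `b` takes to a unit vector, and a
base point. The operator `V` that takes the base points to these vectors lies in the uniform Roe
algebra, and `b V` is a partial isometry. -/
theorem BlockFiltration.exists_norming (E : BlockFiltration X) (hX : UniformlyLocallyFinite X)
    {n : ℕ} {b : EllTwo X →L[ℂ] EllTwo X} (hb : E.IsBlockDiagonal n b) {δ : ℝ} (hδ : 0 < δ) :
    ∃ V ∈ uniformRoeAlgebra X, ∃ P : Set X, E.expandingSet n b δ ⊆ E.sat n P ∧
      ‖V‖ ≤ δ⁻¹ ∧ star (b * V) * (b * V) = projOp P := by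
  classical
  set S := E.expandingSet n b δ
  have hSsat : E.IsSaturated n S := E.isSaturated_expandingSet n b δ
  have hex : ∀ x, ∃ φ, x ∈ S → projOp (E.block n x) φ = φ ∧ ‖b φ‖ = 1 ∧ ‖φ‖ ≤ δ⁻¹ := by
    intro x
    by_cases hx : x ∈ S
    · obtain ⟨φ, hφ, hlt⟩ := hx
      have hpos : 0 < ‖b φ‖ := lt_of_le_of_lt (by positivity) hlt
      refine ⟨((‖b φ‖⁻¹ : ℝ) : ℂ) • φ, fun _ => ⟨?_, ?_, ?_⟩⟩
      · rw [map_smul, hφ]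
      · rw [map_smul, norm_smul, Complex.norm_real, norm_inv, norm_norm, inv_mul_cancel₀ hpos.ne']
      · rw [norm_smul, Complex.norm_real, norm_inv, norm_norm, inv_mul_le_iff₀ hpos, ← div_eq_mul_inv,
          le_div_iff₀ hδ, mul_comm]
        exact hlt.le
    · exact ⟨0, fun h => absurd h hx⟩
  choose w hw using hex
  -- `r x` is the base point of the block of `x`
  let r : X → X := fun x => (Quotient.mk (E.rel n) x).out
  have hr : ∀ x, E.rel n (r x) x := fun x => Quotient.mk_out x
  have hr' : ∀ x y, E.rel n x y → r x = r y := fun x y h =>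
    congrArg Quotient.out (Quotient.sound (s := E.rel n) h)
  have hrS : ∀ x ∈ S, r x ∈ S := fun x hx => hSsat x (r x) ((E.rel n).symm (hr x)) hx
  have hout : ∀ x ∈ S, ∀ y ∉ E.block n x, w x y = 0 := fun x hx y hy => by
    rw [← (hw x hx).1, projOp_apply_of_notMem _ hy]
  let g : X → ℂ := fun x => if x ∈ S then w (r x) x else 0
  have hg : ∀ x, ‖g x‖ ≤ δ⁻¹ := by
    intro x
    by_cases hx : x ∈ S
    · simp only [g, if_pos hx]
      exact (lp.norm_apply_le_norm two_ne_zero _ _).trans (hw (r x) (hrS x hx)).2.2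
    · simp only [g, if_neg hx, norm_zero]
      positivity
  obtain ⟨V, hV, hVφ⟩ := E.exists_weighted hX n g _ hg r hr
  -- On vectors supported in one block, `V` has rank at most one.
  have hVblock : ∀ x φ, projOp (E.block n x) φ = φ →
      V φ = if x ∈ S then φ (r x) • w (r x) else 0 := by
    intro x φ hφ
    ext y
    rw [hVφ]
    by_cases hy : E.rel n y x
    · rw [hr' y x hy]
      by_cases hx : x ∈ S
      · have hyS : y ∈ S := hSsat x y ((E.rel n).symm hy) hx
        simp only [g, if_pos hyS, if_pos hx, hr' y x hy]
        exact mul_comm _ _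
      · have hyS : y ∉ S := fun h => hx (hSsat y x hy h)
        simp only [g, if_neg hyS, if_neg hx, zero_mul]
        rfl
    · have h1 : φ (r y) = 0 := by
        rw [← hφ, projOp_apply_of_notMem]
        exact fun h => hy ((E.rel n).trans ((E.rel n).symm (hr y)) h)
      rw [h1, mul_zero]
      split_ifs with hx
      · have h2 : w (r x) y = 0 := hout _ (hrS x hx) y fun h => hy ((E.rel n).trans h (hr x))
        change 0 = φ (r x) * w (r x) y
        rw [h2, mul_zero]
      · rfl
  have hVdiag : E.IsBlockDiagonal n V := by
    intro T hT
    ext φ y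
    change projOp T (V φ) y = V (projOp T φ) y
    rw [hVφ]
    by_cases hy : y ∈ T
    · rw [projOp_apply_of_mem _ hy, hVφ,
        projOp_apply_of_mem _ (hT y (r y) ((E.rel n).symm (hr y)) hy)]
    · rw [projOp_apply_of_notMem _ hy,
        projOp_apply_of_notMem _ (fun h => hy (hT (r y) y (hr y) h)), mul_zero]
  have hVnorm : ‖V‖ ≤ δ⁻¹ := by
    refine ContinuousLinearMap.opNorm_le_bound _ (by positivity)
      (hVdiag.norm_apply_le (by positivity) fun x φ hφ => ?_)
    rw [hVblock x φ hφ]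
    split_ifs with hx
    · rw [norm_smul, mul_comm]
      exact mul_le_mul (hw _ (hrS x hx)).2.2 (lp.norm_apply_le_norm two_ne_zero _ _)
        (norm_nonneg _) (by positivity)
    · rw [norm_zero]
      positivity
  have hVsingle : ∀ x, V (lp.single 2 x (1 : ℂ)) = if x ∈ S ∧ r x = x then w x else 0 := by
    intro x
    rw [hVblock x]
    · by_cases hx : x ∈ S
      · by_cases hrx : r x = x
        · simp [hx, hrx]
        · simp [hx, hrx]
      · simp [hx]
    · ext y
      by_cases hy : y ∈ E.block n x
      · rw [projOp_apply_of_mem _ hy]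
      · rw [projOp_apply_of_notMem _ hy, lp.single_apply_ne]
        rintro rfl
        exact hy ((E.rel n).refl _)
  refine ⟨V, hV, {x | x ∈ S ∧ r x = x}, fun x hx =>
    ⟨r x, ⟨hrS x hx, hr' _ _ (hr x)⟩, (E.rel n).symm (hr x)⟩, hVnorm,
    eq_projOp_of_inner_single fun x y => ?_⟩
  rw [mul_apply_eq_comp, mul_apply_eq_comp, hVsingle, hVsingle]
  by_cases hx : x ∈ S ∧ r x = x
  · by_cases hy : y ∈ S ∧ r y = y
    · rw [if_pos hx, if_pos hy]
      by_cases hxy : x = y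
      · subst hxy
        rw [if_pos ⟨rfl, hx⟩, inner_self_eq_norm_sq_to_K, (hw x hx.1).2.1]
        simp
      · have hcomm : ∀ z ∈ S, b (w z) = projOp (E.block n z) (b (w z)) := fun z hz => by
          conv_lhs => rw [← (hw z hz).1]
          exact (congrArg (fun a : EllTwo X →L[ℂ] EllTwo X => a (w z))
            (hb _ (E.isSaturated_block n z))).symm
        rw [if_neg fun h => hxy h.1, hcomm x hx.1, hcomm y hy.1, inner_projOp_projOp]
        rw [Set.disjoint_left]
        intro z hzx hzy
        refine hxy ?_
        rw [← hx.2, ← hy.2]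
        exact hr' x y ((E.rel n).trans ((E.rel n).symm hzx) hzy)
    · rw [if_neg hy, map_zero, inner_zero_right, if_neg]
      rintro ⟨rfl, -⟩
      exact hy hx
  · rw [if_neg hx, map_zero, inner_zero_left, if_neg]
    rintro ⟨-, h⟩
    exact hx h

/-- If the block diagonal operator `b` is close to an element of the ideal `I`, then the blocks on
which `b` is large belong to `I`. -/
theorem BlockFiltration.roeProj_expandingSet_mem (E : BlockFiltration X)
    (hX : UniformlyLocallyFinite X) (I : TwoSidedIdeal (uniformRoeAlgebra X))
    {a b : uniformRoeAlgebra X} (ha : a ∈ I) {n : ℕ} (hb : E.IsBlockDiagonal n b.1) {δ : ℝ}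
    (hδ : 0 < δ) (hab : ‖star b * b - star a * a‖ < δ ^ 2) :
    roeProj (E.expandingSet n b.1 δ) ∈ I := by
  obtain ⟨V, hV, P, hP, hVn, hVb⟩ := E.exists_norming hX hb hδ
  let v : uniformRoeAlgebra X := ⟨V, hV⟩
  have hvn : ‖v‖ ≤ δ⁻¹ := hVn
  have hv : roeProj P = star (b * v) * (b * v) := Subtype.ext hVb.symm
  have hPI : roeProj P ∈ I := by
    refine I.mem_of_norm_sub_lt_one (x := star v * (star a * a) * v)
      (by rw [roeProj_mul_roeProj, Set.inter_self])
      (I.mul_mem_right _ _ (I.mul_mem_left _ _ (I.mul_mem_left _ _ ha))) ?_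
    have : roeProj P - star v * (star a * a) * v = star v * (star b * b - star a * a) * v := by
      rw [hv, star_mul]
      noncomm_ring
    rw [this]
    calc ‖star v * (star b * b - star a * a) * v‖
        ≤ ‖star v‖ * ‖star b * b - star a * a‖ * ‖v‖ := norm_mul₃_le
      _ ≤ δ⁻¹ * ‖star b * b - star a * a‖ * δ⁻¹ := by
          rw [norm_star]
          gcongr
      _ < δ⁻¹ * δ ^ 2 * δ⁻¹ := by gcongr
      _ = 1 := by field_simp
  exact roeProj_mem_of_subset I (roeProj_sat_mem I E hX n hPI) hP

/-- Closed ideals of the uniform Roe algebra are determined by the projections `1_T` that they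
contain. -/
theorem BlockFiltration.ideal_le_of_roeProj (E : BlockFiltration X)
    (hX : UniformlyLocallyFinite X) (I J : TwoSidedIdeal (uniformRoeAlgebra X))
    (hJ : IsClosed (J : Set (uniformRoeAlgebra X)))
    (h : ∀ T, roeProj T ∈ I → roeProj T ∈ J) : I ≤ J := by
  intro a ha
  change a ∈ (J : Set (uniformRoeAlgebra X))
  rw [← hJ.closure_eq, Metric.mem_closure_iff]
  intro ε hε
  have hev : ∀ᶠ b in 𝓝 a, ‖star b * b - star a * a‖ < (ε / 2) ^ 2 ∧ ‖a - b‖ < ε / 2 := by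
    have h1 : Tendsto (fun b => ‖star b * b - star a * a‖) (𝓝 a) (𝓝 0) := by
      have : Continuous fun b => ‖star b * b - star a * a‖ := by fun_prop
      simpa using this.tendsto a
    have h2 : Tendsto (fun b => ‖a - b‖) (𝓝 a) (𝓝 0) := by
      have : Continuous fun b => ‖a - b‖ := by fun_prop
      simpa using this.tendsto a
    exact (h1.eventually_lt_const (by positivity)).and (h2.eventually_lt_const (by positivity))
  obtain ⟨b, ⟨hb1, hb2⟩, n, hb⟩ := mem_closure_iff_nhds.1 (E.dense_isBlockDiagonal a) _ hev
  set S := E.expandingSet n b.1 (ε / 2)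
  have hSsat : E.IsSaturated n S := E.isSaturated_expandingSet n b.1 _
  have hS : roeProj S ∈ J := h _ (E.roeProj_expandingSet_mem hX I ha hb (half_pos hε) hb1)
  refine ⟨b * roeProj S, J.mul_mem_left _ _ hS, ?_⟩
  have hrest : ‖b * roeProj Sᶜ‖ ≤ ε / 2 := by
    refine ContinuousLinearMap.opNorm_le_bound _ (half_pos hε).le
      ((hb.mul (isBlockDiagonal_projOp n Sᶜ)).norm_apply_le (half_pos hε).le fun x φ hφ => ?_)
    by_cases hx : x ∈ S
    · have h0 : projOp Sᶜ φ = 0 := by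
        rw [← hφ]
        change (projOp Sᶜ * projOp (E.block n x)) φ = 0
        rw [projOp_mul_projOp]
        have : Sᶜ ∩ E.block n x = ∅ := by
          ext y
          simp only [Set.mem_inter_iff, Set.mem_compl_iff, Set.mem_empty_iff_false, iff_false,
            not_and]
          exact fun hy hyx => hy (hSsat x y ((E.rel n).symm hyx) hx)
        rw [this, projOp_empty]
        rfl
      change ‖b.1 (projOp Sᶜ φ)‖ ≤ _
      rw [h0, map_zero, norm_zero]
      positivity
    · have h1 : projOp Sᶜ φ = φ := by
        conv_rhs => rw [← hφ]
        conv_lhs => rw [← hφ]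
        change (projOp Sᶜ * projOp (E.block n x)) φ = _
        rw [projOp_mul_projOp]
        have : Sᶜ ∩ E.block n x = E.block n x :=
          Set.inter_eq_right.2 fun y hyx hy => hx (hSsat y x hyx hy)
        rw [this]
      change ‖b.1 (projOp Sᶜ φ)‖ ≤ _
      rw [h1]
      by_contra hcon
      exact hx ⟨φ, hφ, not_le.1 hcon⟩
  have hsplit : a - b * roeProj S = (a - b) + b * roeProj Sᶜ := by
    have : (1 : uniformRoeAlgebra X) = roeProj S + roeProj Sᶜ := by
      rw [← roeProj_union disjoint_compl_right, Set.union_compl_self, roeProj_univ]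
    have h2 : b = b * roeProj S + b * roeProj Sᶜ := by rw [← mul_add, ← this, mul_one]
    nth_rewrite 2 [h2]
    abel
  rw [dist_eq_norm, hsplit]
  calc _ ≤ ‖a - b‖ + ‖b * roeProj Sᶜ‖ := norm_add_le _ _
    _ < ε / 2 + ε / 2 := by linarith
    _ = ε := add_halves ε

end IdealDetermination

/-! ### Representations of C*-algebras -/

section Representations

open scoped ComplexOrder in
/-- The GNS representation of a positive functional, together with its cyclic vector. -/
theorem exists_cyclic_representation {A : Type u} [CStarAlgebra A] (f : A →ₗ[ℂ] ℂ)
    (hf : ∀ a, 0 ≤ f (star a * a)) :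
    ∃ (H : Type u) (_ : NormedAddCommGroup H) (_ : InnerProductSpace ℂ H) (_ : CompleteSpace H)
      (π : A →⋆ₐ[ℂ] (H →L[ℂ] H)) (Ω : H),
      (∀ a, inner ℂ (π a Ω) (π a Ω) = f (star a * a)) ∧ DenseRange fun a => π a Ω := by
  let _ := CStarAlgebra.spectralOrder A
  let _ := CStarAlgebra.spectralOrderedRing A
  let F : A →ₚ[ℂ] ℂ := PositiveLinearMap.mk₀ f fun x hx => by
    obtain ⟨b, rfl⟩ := CStarAlgebra.nonneg_iff_eq_star_mul_self.1 hx
    exact hf b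
  have hΩ : ∀ a, F.gnsStarAlgHom a ((F.toPreGNS 1 : F.PreGNS) : F.GNS) =
      ((F.toPreGNS a : F.PreGNS) : F.GNS) := fun a => by
    change F.gnsNonUnitalStarAlgHom a _ = _
    rw [PositiveLinearMap.gnsNonUnitalStarAlgHom_apply_coe,
      PositiveLinearMap.leftMulMapPreGNS_apply]
    simp
  refine ⟨F.GNS, inferInstance, inferInstance, inferInstance, F.gnsStarAlgHom,
    ((F.toPreGNS 1 : F.PreGNS) : F.GNS), fun a => ?_, ?_⟩
  · rw [hΩ, UniformSpace.Completion.inner_coe, PositiveLinearMap.preGNS_inner_def]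
    rfl
  · simp only [hΩ]
    exact (UniformSpace.Completion.denseRange_coe (α := F.PreGNS)).comp
      F.toPreGNS.surjective.denseRange (UniformSpace.Completion.continuous_coe _)

variable {A : Type u} [CStarAlgebra A] {H : Type u} [NormedAddCommGroup H] [InnerProductSpace ℂ H]
  [CompleteSpace H]

theorem StarAlgHom.norm_apply_apply_le (π : A →⋆ₐ[ℂ] (H →L[ℂ] H)) (a : A) (v : H) :
    ‖π a v‖ ≤ ‖a‖ * ‖v‖ :=
  (ContinuousLinearMap.le_opNorm _ _).trans
    (mul_le_mul_of_nonneg_right (NonUnitalStarAlgHom.norm_apply_le π a) (norm_nonneg _))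

theorem StarAlgHom.continuous_apply_apply (π : A →⋆ₐ[ℂ] (H →L[ℂ] H)) (v : H) :
    Continuous fun a => π a v :=
  (AddMonoidHomClass.continuous_of_bound
    ((LinearMap.applyₗ v).comp ((ContinuousLinearMap.coeLM ℂ).comp
      (π.toAlgHom.toLinearMap)) : A →ₗ[ℂ] H) ‖v‖ fun a => by
        rw [mul_comm]
        exact π.norm_apply_apply_le a v)

/-- A cyclic representation is irreducible if its cyclic vector is excised: the compressions of
each element by suitable `p` that fix the vector are almost scalar. Indeed the component of the
vector in an invariant subspace is then a multiple of the vector. -/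
theorem isIrreducibleRep_of_excision (π : A →⋆ₐ[ℂ] (H →L[ℂ] H)) {Ω : H} (hΩ : Ω ≠ 0)
    (hdense : DenseRange fun a => π a Ω)
    (hex : ∀ a : A, ∀ ε > 0, ∃ (c : ℂ) (p : A), ‖p‖ ≤ 1 ∧ π p Ω = Ω ∧ ‖p * a * p - c • p‖ < ε) :
    IsIrreducibleRep π := by
  refine ⟨⟨Ω, 0, hΩ⟩, fun K hK hinv => ?_⟩
  have : CompleteSpace K := hK.completeSpace_coe
  have hinv' : ∀ a : A, ∀ v ∈ Kᗮ, π a v ∈ Kᗮ := by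
    intro a v hv w hw
    rw [← ContinuousLinearMap.adjoint_inner_left, ← ContinuousLinearMap.star_eq_adjoint,
      ← map_star]
    exact hv _ (hinv _ w hw)
  have hcyc : ∀ L : Submodule ℂ H, IsClosed (L : Set H) → (∀ a : A, ∀ v ∈ L, π a v ∈ L) → Ω ∈ L →
      L = ⊤ := by
    intro L hL hLinv hΩL
    rw [eq_top_iff]
    intro v _
    have h1 : v ∈ closure (Set.range fun a => π a Ω) := hdense v
    refine closure_minimal ?_ hL h1
    rintro _ ⟨a, rfl⟩
    exact hLinv a Ω hΩL
  set k := K.starProjection Ω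
  have hkK : k ∈ K := K.starProjection_apply_mem Ω
  have hkK' : Ω - k ∈ Kᗮ := K.sub_starProjection_mem_orthogonal Ω
  have hfix : ∀ p : A, π p Ω = Ω → π p k = k := by
    intro p hp
    refine (Submodule.eq_starProjection_of_mem_orthogonal (hinv p k hkK) ?_).symm
    have := hinv' p _ hkK'
    rwa [map_sub, hp] at this
  have hkspan : k ∈ Submodule.span ℂ {Ω} := by
    have hcl : IsClosed (Submodule.span ℂ {Ω} : Set H) := Submodule.closed_of_finiteDimensional _
    rw [← SetLike.mem_coe, ← hcl.closure_eq, Metric.mem_closure_iff]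
    intro ε hε
    obtain ⟨_, ⟨a, rfl⟩, ha⟩ := Metric.mem_closure_iff.1 (hdense k) (ε / 2) (half_pos hε)
    have hΩpos : 0 < ‖Ω‖ := norm_pos_iff.2 hΩ
    obtain ⟨c, p, hp1, hpΩ, hp⟩ := hex a (ε / 2 / ‖Ω‖) (by positivity)
    refine ⟨c • Ω, Submodule.smul_mem _ _ (Submodule.mem_span_singleton_self _), ?_⟩
    have hsplit : k - c • Ω = π p (k - π a Ω) + π (p * a * p - c • p) Ω := by
      have h1 : π (p * a * p - c • p) Ω = π p (π a (π p Ω)) - c • π p Ω := by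
        rw [map_sub, map_mul, map_mul, map_smul]
        rfl
      rw [h1, map_sub, hfix p hpΩ, hpΩ]
      abel
    rw [dist_eq_norm] at ha
    rw [dist_eq_norm, hsplit]
    calc _ ≤ ‖π p (k - π a Ω)‖ + ‖π (p * a * p - c • p) Ω‖ := norm_add_le _ _
      _ ≤ ‖p‖ * ‖k - π a Ω‖ + ‖p * a * p - c • p‖ * ‖Ω‖ :=
          add_le_add (π.norm_apply_apply_le _ _) (π.norm_apply_apply_le _ _)
      _ ≤ 1 * ‖k - π a Ω‖ + ‖p * a * p - c • p‖ * ‖Ω‖ := by gcongr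
      _ < ε / 2 + ε / 2 := by
          refine add_lt_add (by rwa [one_mul]) ?_
          rwa [← lt_div_iff₀ hΩpos]
      _ = ε := add_halves ε
  obtain ⟨c, hc⟩ := Submodule.mem_span_singleton.1 hkspan
  by_cases hc0 : c = 0
  · left
    rw [hc0, zero_smul] at hc
    rw [← hc, sub_zero] at hkK'
    exact K.orthogonal_eq_top_iff.1 (hcyc _ K.isClosed_orthogonal hinv' hkK')
  · right
    refine hcyc K hK hinv ?_
    have : Ω = c⁻¹ • k := by rw [← hc, smul_smul, inv_mul_cancel₀ hc0, one_smul]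
    rw [this]
    exact K.smul_mem _ hkK

theorem isClosed_ker_apply (π : A →⋆ₐ[ℂ] (H →L[ℂ] H)) :
    IsClosed (TwoSidedIdeal.ker π : Set A) := by
  have : (TwoSidedIdeal.ker π : Set A) = ⋂ v : H, {a | π a v = 0} := by
    ext a
    rw [SetLike.mem_coe, TwoSidedIdeal.mem_ker, Set.mem_iInter]
    exact ⟨fun h v => by rw [Set.mem_ofPred_eq, h]; rfl, fun h => ContinuousLinearMap.ext h⟩
  rw [this]
  exact isClosed_iInter fun v => isClosed_eq (π.continuous_apply_apply v) continuous_const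

theorem IsPrimitiveIdeal.isPrimeIdeal {I : TwoSidedIdeal A} (hI : IsPrimitiveIdeal I) :
    IsPrimeIdeal I := by
  obtain ⟨H, _, _, _, π, ⟨hH, hirr⟩, rfl⟩ := hI
  refine ⟨isClosed_ker_apply π, fun h => ?_, fun I₀ I₁ _ _ h => ?_⟩
  · have : (1 : A) ∈ (TwoSidedIdeal.ker π : Set A) := h ▸ Set.mem_univ _
    rw [SetLike.mem_coe, TwoSidedIdeal.mem_ker, map_one] at this
    exact one_ne_zero this
  -- The vectors annihilated by `I₀` form an invariant subspace, which contains the range of `I₁`.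
  · let K : Submodule ℂ H := ⨅ a ∈ I₀, LinearMap.ker (π a).toLinearMap
    have hK : ∀ v, v ∈ K ↔ ∀ a ∈ I₀, π a v = 0 := fun v => by
      simp [K, Submodule.mem_iInf]
    have hKcl : IsClosed (K : Set H) := by
      have : (K : Set H) = ⋂ a ∈ I₀, {v | π a v = 0} := by
        ext v
        rw [SetLike.mem_coe, hK]
        simp
      rw [this]
      exact isClosed_biInter fun a _ => isClosed_eq (π a).continuous continuous_const
    rcases hirr K hKcl fun a v hv => (hK _).2 fun b hb => by
        have := (hK v).1 hv (b * a) (I₀.mul_mem_right _ _ hb)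
        rwa [map_mul] at this with h0 | h0
    · right
      intro b hb
      rw [TwoSidedIdeal.mem_ker]
      ext v
      have : π b v ∈ K := (hK _).2 fun a ha => by
        have := h a ha b hb
        rw [TwoSidedIdeal.mem_ker, map_mul] at this
        exact congrArg (fun T : H →L[ℂ] H => T v) this
      rw [h0, Submodule.mem_bot] at this
      exact this
    · left
      intro a ha
      rw [TwoSidedIdeal.mem_ker]
      ext v
      exact (hK v).1 (h0 ▸ Submodule.mem_top) a ha

end Representations

/-! ### Limit functionals at ultrafilters -/

section LimitFunctional

variable {X : Type u} [MetricSpace X]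

open Classical in
/-- The diagonal matrix entry `⟨δ_x, a δ_x⟩`. -/
noncomputable def diagEntry (a : uniformRoeAlgebra X) (x : X) : ℂ := a.1 (lp.single 2 x (1 : ℂ)) x

open Classical in
theorem norm_diagEntry_le (a : uniformRoeAlgebra X) (x : X) : ‖diagEntry a x‖ ≤ ‖a‖ :=
  (lp.norm_apply_le_norm two_ne_zero _ _).trans
    ((a.1.le_opNorm _).trans_eq (by rw [lp.norm_single (by norm_num), norm_one, mul_one]; rfl))

theorem exists_tendsto_diagEntry (ξ : Ultrafilter X) (a : uniformRoeAlgebra X) :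
    ∃ c, Tendsto (diagEntry a) ξ (𝓝 c) := by
  obtain ⟨c, -, hc⟩ := (isCompact_closedBall (0 : ℂ) ‖a‖).ultrafilter_le_nhds'
    (ξ.map (diagEntry a)) (Ultrafilter.mem_map.2 (Eventually.of_forall fun x => by
      simpa using norm_diagEntry_le a x))
  exact ⟨c, hc⟩

/-- The functional `a ↦ lim_{x → ξ} ⟨δ_x, a δ_x⟩`. -/
noncomputable def limFunctional (ξ : Ultrafilter X) : uniformRoeAlgebra X →ₗ[ℂ] ℂ where
  toFun a := (exists_tendsto_diagEntry ξ a).choose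
  map_add' a b := tendsto_nhds_unique (exists_tendsto_diagEntry ξ (a + b)).choose_spec
    ((exists_tendsto_diagEntry ξ a).choose_spec.add (exists_tendsto_diagEntry ξ b).choose_spec)
  map_smul' c a := tendsto_nhds_unique (exists_tendsto_diagEntry ξ (c • a)).choose_spec
    ((exists_tendsto_diagEntry ξ a).choose_spec.const_smul c)

theorem tendsto_limFunctional (ξ : Ultrafilter X) (a : uniformRoeAlgebra X) :
    Tendsto (diagEntry a) ξ (𝓝 (limFunctional ξ a)) := (exists_tendsto_diagEntry ξ a).choose_spec

open Classical in
theorem diagEntry_star_mul_self (a : uniformRoeAlgebra X) (x : X) :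
    diagEntry (star a * a) x = ((‖a.1 (lp.single 2 x (1 : ℂ))‖ ^ 2 : ℝ) : ℂ) := by
  rw [diagEntry, ← EllTwo.inner_single_one_left]
  change inner ℂ _ ((star a.1) (a.1 _)) = _
  rw [ContinuousLinearMap.star_eq_adjoint, ContinuousLinearMap.adjoint_inner_right,
    inner_self_eq_norm_sq_to_K]
  simp

open scoped ComplexOrder in
theorem limFunctional_star_mul_self_nonneg (ξ : Ultrafilter X) (a : uniformRoeAlgebra X) :
    0 ≤ limFunctional ξ (star a * a) :=
  ge_of_tendsto' (tendsto_limFunctional ξ _) fun x => by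
    rw [diagEntry_star_mul_self]
    exact Complex.zero_le_real.2 (sq_nonneg _)

theorem limFunctional_eq_of_eventually {ξ : Ultrafilter X} {a : uniformRoeAlgebra X} {c : ℂ}
    (h : ∀ᶠ x in (ξ : Filter X), diagEntry a x = c) : limFunctional ξ a = c :=
  tendsto_nhds_unique (tendsto_limFunctional ξ a)
    (tendsto_const_nhds.congr' (h.mono fun _ hx => hx.symm))

/-- The functional at `ξ` is excised by the projections `1_T` with `T ∈ ξ`. -/
theorem BlockFiltration.exists_excision (E : BlockFiltration X) (hX : UniformlyLocallyFinite X)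
    (ξ : Ultrafilter X) (a : uniformRoeAlgebra X) (ε : ℝ) (hε : 0 < ε) :
    ∃ c : ℂ, ∃ T ∈ ξ, ‖roeProj T * a * roeProj T - c • roeProj T‖ < ε := by
  have hcut : ∀ (S T : Set X) (a : uniformRoeAlgebra X) (c : ℂ),
      ‖roeProj (S ∩ T) * a * roeProj (S ∩ T) - c • roeProj (S ∩ T)‖ ≤
        ‖roeProj S * a * roeProj S - c • roeProj S‖ := by
    intro S T a c
    have : roeProj (S ∩ T) * a * roeProj (S ∩ T) - c • roeProj (S ∩ T) =
        roeProj T * (roeProj S * a * roeProj S - c • roeProj S) * roeProj T := by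
      have h1 : roeProj (S ∩ T) = roeProj T * roeProj S := by
        rw [roeProj_mul_roeProj, Set.inter_comm]
      have h2 : roeProj (S ∩ T) = roeProj S * roeProj T := by rw [roeProj_mul_roeProj]
      have h3 : roeProj T * roeProj S * roeProj T = roeProj (S ∩ T) := by
        rw [roeProj_mul_roeProj, roeProj_mul_roeProj, Set.inter_comm T S, Set.inter_assoc,
          Set.inter_self]
      have h4 : roeProj (S ∩ T) * a * roeProj (S ∩ T) =
          roeProj T * roeProj S * a * (roeProj S * roeProj T) := by rw [← h1, ← h2]
      rw [mul_sub, sub_mul, mul_smul_comm, smul_mul_assoc, h3, h4]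
      simp only [mul_assoc]
    rw [this]
    calc _ ≤ ‖roeProj T‖ * ‖roeProj S * a * roeProj S - c • roeProj S‖ * ‖roeProj T‖ :=
          norm_mul₃_le
      _ ≤ 1 * ‖roeProj S * a * roeProj S - c • roeProj S‖ * 1 := by
        gcongr
        · exact norm_roeProj_le T
        · exact norm_roeProj_le T
      _ = ‖roeProj S * a * roeProj S - c • roeProj S‖ := by rw [one_mul, mul_one]
  revert ε
  refine uniformRoeAlgebra_induction (p := fun a => ∀ ε : ℝ, 0 < ε →
    ∃ c : ℂ, ∃ T ∈ ξ, ‖roeProj T * a * roeProj T - c • roeProj T‖ < ε) ?_ ?_ ?_ ?_ ?_ a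
  · rw [← closure_subset_iff_isClosed]
    intro a ha ε hε
    obtain ⟨b, hb, hab⟩ := Metric.mem_closure_iff.1 ha (ε / 2) (half_pos hε)
    obtain ⟨c, T, hT, h⟩ := hb (ε / 2) (half_pos hε)
    refine ⟨c, T, hT, ?_⟩
    have hsplit : roeProj T * a * roeProj T - c • roeProj T =
        roeProj T * (a - b) * roeProj T + (roeProj T * b * roeProj T - c • roeProj T) := by
      rw [mul_sub, sub_mul]
      abel
    rw [dist_eq_norm] at hab
    rw [hsplit]
    calc _ ≤ ‖roeProj T * (a - b) * roeProj T‖ + _ := norm_add_le _ _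
      _ ≤ ‖roeProj T‖ * ‖a - b‖ * ‖roeProj T‖ + _ := by gcongr; exact norm_mul₃_le
      _ ≤ 1 * ‖a - b‖ * 1 + _ := by
        gcongr
        · exact norm_roeProj_le T
        · exact norm_roeProj_le T
      _ < ε / 2 + ε / 2 := by rw [one_mul, mul_one]; exact add_lt_add hab h
      _ = ε := add_halves ε
  · intro f hf ε hε
    by_cases hD : {x | f x = some x} ∈ ξ
    · refine ⟨1, _, hD, ?_⟩
      have : roeProj {x | f x = some x} * roeShift hf * roeProj {x | f x = some x} =
          roeProj {x | f x = some x} := by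
        refine Subtype.ext ?_
        ext φ y
        change projOp _ (f.partialIsometry (projOp _ φ)) y = projOp _ φ y
        by_cases hy : y ∈ {x | f x = some x}
        · rw [projOp_apply_of_mem _ hy, PEquiv.partialIsometry_apply_of_eq_some _ hy]
        · rw [projOp_apply_of_notMem _ hy, projOp_apply_of_notMem _ hy]
      rw [this, one_smul, sub_self, norm_zero]
      exact hε
    -- A point and its image in the same block have different colours unless they are equal.
    · obtain ⟨n, hn⟩ := E.exists_rel_of_mem_partialTranslations hf
      obtain ⟨N, col, hcol⟩ := E.exists_coloring hX n
      have hcov : (⋃ i ∈ (Set.univ : Set (Fin N)), col ⁻¹' {i}) ∈ ξ :=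
        mem_of_superset univ_mem fun x _ => Set.mem_biUnion (Set.mem_univ (col x)) rfl
      obtain ⟨i, -, hi⟩ := (Ultrafilter.finite_biUnion_mem_iff Set.finite_univ).1 hcov
      set T := col ⁻¹' {i} ∩ {x | f x = some x}ᶜ
      refine ⟨0, T, inter_mem hi (Ultrafilter.compl_mem_iff_notMem.2 hD), ?_⟩
      have : roeProj T * roeShift hf * roeProj T = 0 := by
        refine Subtype.ext ?_
        ext φ y
        change projOp T (f.partialIsometry (projOp T φ)) y = 0
        by_cases hy : y ∈ T
        · rw [projOp_apply_of_mem _ hy]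
          rcases h : f.symm y with _ | x
          · rw [PEquiv.partialIsometry_apply, h]
            rfl
          · have hx := f.eq_some_iff.1 h
            rw [PEquiv.partialIsometry_apply_of_eq_some _ hx, projOp_apply_of_notMem]
            intro hxT
            have hxy : x = y := hcol x y (hn x y hx) (hxT.1.trans hy.1.symm)
            subst hxy
            exact hxT.2 hx
        · rw [projOp_apply_of_notMem _ hy]
      rw [this, zero_smul, sub_self, norm_zero]
      exact hε
  · intro ε hε
    refine ⟨0, Set.univ, univ_mem, ?_⟩
    simpa using hε
  · intro a b ha hb ε hε
    obtain ⟨c, S, hS, h⟩ := ha (ε / 2) (half_pos hε)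
    obtain ⟨d, T, hT, h'⟩ := hb (ε / 2) (half_pos hε)
    refine ⟨c + d, S ∩ T, inter_mem hS hT, ?_⟩
    have h2 := hcut T S b d
    rw [Set.inter_comm] at h2
    have hsplit : ∀ p : uniformRoeAlgebra X, p * (a + b) * p - (c + d) • p =
        (p * a * p - c • p) + (p * b * p - d • p) := fun p => by
      rw [mul_add, add_mul, add_smul]
      abel
    rw [hsplit]
    calc _ ≤ _ := norm_add_le _ _
      _ < ε / 2 + ε / 2 := add_lt_add ((hcut S T a c).trans_lt h) (h2.trans_lt h')
      _ = ε := add_halves ε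
  · intro z a ha ε hε
    obtain ⟨c, T, hT, h⟩ := ha (ε / (‖z‖ + 1)) (by positivity)
    refine ⟨z * c, T, hT, ?_⟩
    rw [mul_smul_comm, smul_mul_assoc, mul_smul, ← smul_sub, norm_smul]
    rw [lt_div_iff₀ (by positivity)] at h
    have := norm_nonneg (roeProj T * a * roeProj T - c • roeProj T)
    nlinarith

/-! ### Prime ideals of the uniform Roe algebra -/

/-- The sets `T` with `1_T` in a prime ideal form a prime ideal of sets. -/
theorem BlockFiltration.isPrimeSetIdeal_of_isPrimeIdeal (E : BlockFiltration X)
    (hX : UniformlyLocallyFinite X) {I : TwoSidedIdeal (uniformRoeAlgebra X)}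
    (hI : IsPrimeIdeal I) : E.IsPrimeSetIdeal {T | roeProj T ∈ I} := by
  obtain ⟨hcl, hne, hprime⟩ := hI
  refine ⟨?_, fun S hS T hT => roeProj_union_mem I hS hT,
    fun T hT S hST => roeProj_mem_of_subset I hT hST,
    fun n T hT => roeProj_sat_mem I E hX n hT, fun h => hne ?_, fun S hS T hT => ?_⟩
  · rw [Set.mem_ofPred_eq, roeProj_empty]
    exact I.zero_mem
  · rw [Set.mem_ofPred_eq, roeProj_univ] at h
    exact Set.eq_univ_of_forall fun a => by simpa using I.mul_mem_left a 1 h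
  · by_contra! hcon
    have key : ∀ a, roeProj S * a * roeProj T ∈ I := by
      refine uniformRoeAlgebra_induction ?_ ?_ ?_ ?_ ?_
      · have : Continuous fun a : uniformRoeAlgebra X => roeProj S * a * roeProj T := by fun_prop
        exact hcl.preimage this
      · intro f hf
        obtain ⟨n, hn⟩ := E.exists_rel_of_mem_partialTranslations hf
        -- `1_S v_f 1_T` has its range in the part of `S` that `f` reaches from `T`
        have : roeProj S * roeShift hf * roeProj T =
            roeProj (E.sat n S ∩ E.sat n T) * (roeProj S * roeShift hf * roeProj T) := by
          refine Subtype.ext ?_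
          ext φ y
          change projOp S (f.partialIsometry (projOp T φ)) y =
            projOp _ (projOp S (f.partialIsometry (projOp T φ))) y
          by_cases hy : y ∈ E.sat n S ∩ E.sat n T
          · rw [projOp_apply_of_mem _ hy]
          · rw [projOp_apply_of_notMem _ hy]
            by_cases hyS : y ∈ S
            · rw [projOp_apply_of_mem _ hyS]
              rcases h : f.symm y with _ | x
              · rw [PEquiv.partialIsometry_apply, h]
                rfl
              · have hx := f.eq_some_iff.1 h
                rw [PEquiv.partialIsometry_apply_of_eq_some _ hx, projOp_apply_of_notMem]
                exact fun hxT => hy ⟨E.subset_sat n S hyS, x, hxT, (E.rel n).symm (hn x y hx)⟩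
            · rw [projOp_apply_of_notMem _ hyS]
        rw [this]
        exact I.mul_mem_right _ _ (hcon n)
      · rw [mul_zero, zero_mul]
        exact I.zero_mem
      · intro a b ha hb
        rw [mul_add, add_mul]
        exact I.add_mem ha hb
      · intro c a ha
        rw [mul_smul_comm, smul_mul_assoc, ← one_mul (roeProj S * a * roeProj T),
          ← smul_mul_assoc]
        exact I.mul_mem_left _ _ ha
    -- `I₀` is the annihilator of `1_T` modulo `I`, and `I₁` is the annihilator of `I₀`.
    let I₀ : TwoSidedIdeal (uniformRoeAlgebra X) := .mk' {a | ∀ c, a * c * roeProj T ∈ I}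
      (fun c => by rw [zero_mul, zero_mul]; exact I.zero_mem)
      (fun {a b} ha hb c => by rw [add_mul, add_mul]; exact I.add_mem (ha c) (hb c))
      (fun {a} ha c => by rw [neg_mul, neg_mul]; exact I.neg_mem (ha c))
      (fun {x a} ha c => by
        rw [mul_assoc, mul_assoc, ← mul_assoc a]
        exact I.mul_mem_left _ _ (ha c))
      (fun {a x} ha c => by rw [mul_assoc a]; exact ha _)
    have hI₀ : ∀ a, a ∈ I₀ ↔ ∀ c, a * c * roeProj T ∈ I := fun a => TwoSidedIdeal.mem_mk' ..
    let I₁ : TwoSidedIdeal (uniformRoeAlgebra X) := .mk' {b | ∀ a ∈ I₀, a * b ∈ I}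
      (fun a _ => by rw [mul_zero]; exact I.zero_mem)
      (fun {b b'} hb hb' a ha => by rw [mul_add]; exact I.add_mem (hb a ha) (hb' a ha))
      (fun {b} hb a ha => by rw [mul_neg]; exact I.neg_mem (hb a ha))
      (fun {x b} hb a ha => by
        rw [← mul_assoc]
        exact hb _ (I₀.mul_mem_right _ _ ha))
      (fun {b x} hb a ha => by
        rw [← mul_assoc]
        exact I.mul_mem_right _ _ (hb a ha))
    have hI₁ : ∀ b, b ∈ I₁ ↔ ∀ a ∈ I₀, a * b ∈ I := fun b => TwoSidedIdeal.mem_mk' ..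
    have hcl₀ : IsClosed (I₀ : Set (uniformRoeAlgebra X)) := by
      have : (I₀ : Set (uniformRoeAlgebra X)) = ⋂ c, {a | a * c * roeProj T ∈ I} := by
        ext a
        rw [SetLike.mem_coe, hI₀, Set.mem_iInter]
        rfl
      rw [this]
      refine isClosed_iInter fun c => hcl.preimage ?_
      fun_prop
    have hcl₁ : IsClosed (I₁ : Set (uniformRoeAlgebra X)) := by
      have : (I₁ : Set (uniformRoeAlgebra X)) = ⋂ a ∈ I₀, {b | a * b ∈ I} := by
        ext b
        rw [SetLike.mem_coe, hI₁, Set.mem_iInter₂]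
        rfl
      rw [this]
      refine isClosed_biInter fun a _ => hcl.preimage ?_
      fun_prop
    rcases hprime I₀ I₁ hcl₀ hcl₁ fun a ha b hb => (hI₁ b).1 hb a ha with h | h
    · exact hS (h ((hI₀ _).2 key))
    · refine hT (h ((hI₁ _).2 fun a ha => ?_))
      simpa using (hI₀ a).1 ha 1

/-- A prime ideal is the kernel of the GNS representation of the limit functional at a generic
ultrafilter of its ideal of sets: both ideals contain the same projections `1_T`. -/
theorem BlockFiltration.isPrimitiveIdeal_of_isPrimeIdeal (E : BlockFiltration X)
    (hX : UniformlyLocallyFinite X)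
    (hgen : ∀ I : Set (Set X), E.IsPrimeSetIdeal I →
      ∃ ξ : Ultrafilter X, ∀ A, A ∈ I ↔ ∀ n, E.sat n A ∉ ξ)
    {I : TwoSidedIdeal (uniformRoeAlgebra X)} (hI : IsPrimeIdeal I) : IsPrimitiveIdeal I := by
  classical
  obtain ⟨ξ, hξ⟩ := hgen _ (E.isPrimeSetIdeal_of_isPrimeIdeal hX hI)
  obtain ⟨H, _, _, _, π, Ω, hinner, hdense⟩ :=
    exists_cyclic_representation (limFunctional ξ) (limFunctional_star_mul_self_nonneg ξ)
  have hnormsq : ∀ (a : uniformRoeAlgebra X) (c : ℝ),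
      (∀ᶠ x in (ξ : Filter X), ‖a.1 (lp.single 2 x (1 : ℂ))‖ ^ 2 = c) → ‖π a Ω‖ ^ 2 = c := by
    intro a c h
    have h1 := hinner a
    rw [inner_self_eq_norm_sq_to_K, limFunctional_eq_of_eventually (c := (c : ℂ))
      (h.mono fun x hx => by rw [diagEntry_star_mul_self, hx])] at h1
    exact Complex.ofReal_injective (by simpa using h1)
  -- `1_T` fixes `Ω` because `1 - 1_T` annihilates `δ_x` for `x ∈ T`.
  have hproj : ∀ T ∈ ξ, π (roeProj T) Ω = Ω := by
    intro T hT
    have h1 : ‖π (roeProj Tᶜ) Ω‖ ^ 2 = 0 := by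
      refine hnormsq _ 0 (mem_of_superset hT fun x hx => ?_)
      have : projOp Tᶜ (lp.single 2 x (1 : ℂ)) = 0 := by
        ext y
        by_cases hy : y ∈ Tᶜ
        · rw [projOp_apply_of_mem _ hy, lp.single_apply_ne]
          · rfl
          · rintro rfl
            exact hy hx
        · rw [projOp_apply_of_notMem _ hy]
          rfl
      change ‖projOp Tᶜ (lp.single 2 x (1 : ℂ))‖ ^ 2 = 0
      rw [this]
      simp
    have h2 : π (roeProj Tᶜ) Ω = 0 := by simpa using h1
    have h3 : (1 : uniformRoeAlgebra X) = roeProj T + roeProj Tᶜ := by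
      rw [← roeProj_union disjoint_compl_right, Set.union_compl_self, roeProj_univ]
    have h4 : π (1 : uniformRoeAlgebra X) Ω = Ω := by rw [map_one]; rfl
    rw [h3, map_add] at h4
    change π (roeProj T) Ω + π (roeProj Tᶜ) Ω = Ω at h4
    rwa [h2, add_zero] at h4
  have hΩ : Ω ≠ 0 := by
    have h1 := hnormsq 1 1 (Eventually.of_forall fun x => by
      change ‖(lp.single 2 x (1 : ℂ) : EllTwo X)‖ ^ 2 = 1
      rw [lp.norm_single (by norm_num)]
      simp)
    rintro rfl
    simp at h1
  have hirr : IsIrreducibleRep π := isIrreducibleRep_of_excision π hΩ hdense fun a ε hε => by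
    obtain ⟨c, T, hT, h⟩ := E.exists_excision hX ξ a ε hε
    exact ⟨c, roeProj T, norm_roeProj_le T, hproj T hT, h⟩
  have hker : ∀ T, roeProj T ∈ I ↔ roeProj T ∈ TwoSidedIdeal.ker π := by
    intro T
    refine (hξ T).trans ?_
    rw [TwoSidedIdeal.mem_ker]
    constructor
    · intro hT
      have h0 : ∀ a, π (roeProj T * a) Ω = 0 := by
        refine uniformRoeAlgebra_induction ?_ ?_ ?_ ?_ ?_
        · exact isClosed_eq ((π.continuous_apply_apply Ω).comp (continuous_const_mul _))
            continuous_const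
        · intro f hf
          obtain ⟨n, hn⟩ := E.exists_rel_of_mem_partialTranslations hf
          have h1 : ‖π (roeProj T * roeShift hf) Ω‖ ^ 2 = 0 := by
            refine hnormsq _ 0 (mem_of_superset (Ultrafilter.compl_mem_iff_notMem.2 (hT n))
              fun x hx => ?_)
            have : projOp T (f.partialIsometry (lp.single 2 x (1 : ℂ))) = 0 := by
              rcases h : f x with _ | y
              · rw [f.partialIsometry_single_of_eq_none h, map_zero]
              · rw [f.partialIsometry_single_of_eq_some h]
                ext z
                by_cases hz : z ∈ T
                · rw [projOp_apply_of_mem _ hz, lp.single_apply_ne]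
                  · rfl
                  · rintro rfl
                    exact hx ⟨z, hz, hn x z h⟩
                · rw [projOp_apply_of_notMem _ hz]
                  rfl
            change ‖projOp T (f.partialIsometry (lp.single 2 x (1 : ℂ)))‖ ^ 2 = 0
            rw [this]
            simp
          simpa using h1
        · rw [mul_zero, map_zero]
          rfl
        · intro a b ha hb
          rw [mul_add, map_add]
          change π (roeProj T * a) Ω + π (roeProj T * b) Ω = 0
          rw [ha, hb, add_zero]
        · intro c a ha
          rw [mul_smul_comm, map_smul]
          change c • π (roeProj T * a) Ω = 0
          rw [ha, smul_zero]
      refine ContinuousLinearMap.ext fun v => ?_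
      refine congrFun (hdense.equalizer (π (roeProj T)).continuous continuous_const
        (funext fun a => ?_)) v
      have := h0 a
      rw [map_mul] at this
      exact this
    · intro hT n hn
      obtain ⟨f, hf, hd, hfT⟩ := E.exists_partialTranslation_of_sat_mem hX hn
      have h1 : ‖π (roeProj T * roeShift hf) Ω‖ ^ 2 = 1 := by
        refine hnormsq _ 1 (mem_of_superset hd fun x hx => ?_)
        obtain ⟨y, hy⟩ := PEquiv.mem_domain.1 hx
        have : projOp T (lp.single 2 y (1 : ℂ)) = lp.single 2 y (1 : ℂ) := by
          ext z
          by_cases hz : z ∈ T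
          · rw [projOp_apply_of_mem _ hz]
          · rw [projOp_apply_of_notMem _ hz, lp.single_apply_ne]
            rintro rfl
            exact hz (hfT x z hy)
        change ‖projOp T (f.partialIsometry (lp.single 2 x (1 : ℂ)))‖ ^ 2 = 1
        rw [f.partialIsometry_single_of_eq_some hy, this, lp.norm_single (by norm_num)]
        simp
      rw [map_mul, hT, zero_mul] at h1
      simp at h1
  refine ⟨H, _, _, _, π, hirr, le_antisymm ?_ ?_⟩
  · exact E.ideal_le_of_roeProj hX _ _ (isClosed_ker_apply π) fun T => (hker T).1
  · exact E.ideal_le_of_roeProj hX _ _ hI.1 fun T => (hker T).2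

end LimitFunctional

theorem mainTheorem11 :
    (∀ (X : Type u) [MetricSpace X], UniformlyLocallyFinite X →
      ∀ (k : ℕ) (f : X → SpaceM.layersUpTo k), IsCoarseEmbedding f →
        (∀ F : Set (OrbitSpace X), IsClosed F → IsIrreducible F →
          ∃ p : OrbitSpace X, F = closure {p}) ∧
        (∀ I : TwoSidedIdeal (uniformRoeAlgebra X), IsPrimeIdeal I ↔ IsPrimitiveIdeal I)) ∧
    (∀ k : ℕ, 2 ≤ k →
      UniformlyLocallyFinite (SpaceM.layersUpTo k) ∧
        ¬ T1Space (OrbitSpace (SpaceM.layersUpTo k))) := by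
  refine ⟨fun X _ hX k f hf => ?_, fun k hk =>
    ⟨SpaceM.uniformlyLocallyFinite_layersUpTo k, not_t1Space_orbitSpace_layersUpTo hk⟩⟩
  have hgen : ∀ I : Set (Set X), hf.blockFiltration.IsPrimeSetIdeal I →
      ∃ ξ : Ultrafilter X, ∀ A, A ∈ I ↔ ∀ n, hf.blockFiltration.sat n A ∉ ξ :=
    fun _ hI => hI.exists_generic hf.isTailFiltration
  exact ⟨hf.blockFiltration.exists_eq_closure_singleton hX hgen, fun I =>
    ⟨hf.blockFiltration.isPrimitiveIdeal_of_isPrimeIdeal hX hgen, fun hI => hI.isPrimeIdeal⟩⟩
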